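/- For $n=2$ let $\boldsymbol A=(A_1,A_2)$ with $A_k=\begin{bmatrix}a_k&b_k\\c_k&d_k\end{bmatrix}$ real of determinant $1$ and $b_k\neq0$, $c_k\neq0$ ($k=1,2$); call such $\boldsymbol A$ admissible. For $j\in\{1,2\}$, $f\in\mathscr S(\mathbb R^2)$ and $\boldsymbol x\in\mathbb R^2$, the linear canonical Riesz transform is $$R_j^{\boldsymbol A}f(\boldsymbol x):=\widetilde c_2\,e^{-i\sum_{k=1}^2\frac{d_k}{2b_k}x_k^2}\ \mathrm{p.v.}\!\int_{\mathbb R^2}\frac{(x_j-y_j)f(\boldsymbol y)\,e^{i\sum_{k=1}^2\frac{a_k}{2b_k}y_k^2}}{|\boldsymbol x-\boldsymbol y|^3}\,d\boldsymbol y,\qquad \widetilde c_2:=\frac{\Gamma(3/2)}{\pi^{3/2}},$$ where $\mathrm{p.v.}\int:=\lim_{\varepsilon\to0^+}\int_{|\boldsymbol x-\boldsymbol y|\ge\varepsilon}$, and the classical Riesz transform is $$R_jf(\boldsymbol x):=\widetilde c_2\ \mathrm{p.v.}\!\int_{\mathbb R^2}\frac{(x_j-y_j)f(\boldsymbol y)}{|\boldsymbol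 x-\boldsymbol y|^3}\,d\boldsymbol y.$$ The sharpness of $A_k$ is $R^{\rm E}_{\rm sc}(A_k):=b_k/c_k$. For $p\in(1,\infty)$, $R_j^{\boldsymbol A}$ (for admissible $\boldsymbol A$) and $R_j$ extend from $\mathscr S(\mathbb R^2)$ to bounded linear operators on $L^p(\mathbb R^2)$, defined at $f\in L^p(\mathbb R^2)$ as the limit in $L^p$ of the values at Schwartz functions converging to $f$ in $L^p$; the extensions are denoted by the same symbols. Below, $\lim$ denotes the limit over admissible $\boldsymbol A$ as $R^{\rm E}_{\rm sc}(A_k)\to-1$, $a_k\to0$ and $d_k\to0$ for both $k=1,2$. Then, for $j\in\{1,2\}$: (i) for every admissible $\boldsymbol A$, $f\in\mathscr S(\mathbb R^2)$ and $\boldsymbol x\in\mathbb R^2$, the principal value below exists and $$R_j^{\boldsymbol A}f(\boldsymbol x)=\widetilde c_2\,e^{-i\sum_{k=1}^2\frac{d_kx_k^2}{2R^{\rm E}_{\rm sc}(A_k)c_k}}\ \mathrm{p.v.}\!\int_{\mathbb R^2}\frac{(x_j-y_j)f(\boldsymbol y)\,e^{i\sum_{k=1}^2\frac{a_ky_k^2}{2R^{\rm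 E}_{\rm sc}(A_k)c_k}}}{|\boldsymbol x-\boldsymbol y|^3}\,d\boldsymbol y;$$ (ii) for every $f\in\mathscr S(\mathbb R^2)$ and $\boldsymbol x\in\mathbb R^2$, $\lim R_j^{\boldsymbol A}f(\boldsymbol x)=R_jf(\boldsymbol x)$; (iii) for every $p\in(1,\infty)$ and $f\in L^p(\mathbb R^2)$, $\lim\|R_j^{\boldsymbol A}f-R_jf\|_{L^p(\mathbb R^2)}=0$; (iv) for every $p\in(1,\infty)$ and $f\in L^p(\mathbb R^2)$, $\lim R_j^{\boldsymbol A}f=R_jf$ in $\mathscr S'(\mathbb R^2)$, that is, $\lim\int_{\mathbb R^2}R_j^{\boldsymbol A}f\,\phi\,d\boldsymbol x=\int_{\mathbb R^2}R_jf\,\phi\,d\boldsymbol x$ for every $\phi\in\mathscr S(\mathbb R^2)$. -/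

import Mathlib

open Filter Topology MeasureTheory
open scoped ENNReal SchwartzMap MatrixGroups

noncomputable section

/-- `IsPV x F L`: the principal value at `x` of the integral of `F` exists and equals `L`, i.e. `F`
is integrable on `{y : ε ≤ |x - y|}` for each `ε > 0` and the integrals of `F` over these sets
converge to `L` as `ε → 0⁺`. -/
def IsPV {n : ℕ} (x : EuclideanSpace ℝ (Fin n)) (F : EuclideanSpace ℝ (Fin n) → ℂ) (L : ℂ) :
    Prop :=
  (∀ ε : ℝ, 0 < ε → IntegrableOn F {y | ε ≤ ‖x - y‖}) ∧
    Tendsto (fun ε : ℝ => ∫ y in {y | ε ≤ ‖x - y‖}, F y) (𝓝[>] 0) (𝓝 L)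

/-- The principal value at `x` of the integral of `F`: the limit of the truncated integrals
(meaningful when some `L` satisfies `IsPV x F L`, which is then this number). -/
def pvIntegral {n : ℕ} (x : EuclideanSpace ℝ (Fin n)) (F : EuclideanSpace ℝ (Fin n) → ℂ) : ℂ :=
  limUnder (𝓝[>] (0 : ℝ)) (fun ε : ℝ => ∫ y in {y | ε ≤ ‖x - y‖}, F y)

/-- The constant `Γ((n+1)/2) / π^((n+1)/2)`. -/
def rieszConst (n : ℕ) : ℝ :=
  Real.Gamma (((n : ℝ) + 1) / 2) / Real.pi ^ (((n : ℝ) + 1) / 2)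

/-- The chirp function `e_{a,b}(x) = exp (i ∑ₖ bₖ / (2 aₖ) xₖ²)`. -/
def chirp {n : ℕ} (a b : Fin n → ℝ) (x : EuclideanSpace ℝ (Fin n)) : ℂ :=
  Complex.exp (Complex.I * ((∑ k, b k / (2 * a k) * x k ^ 2 : ℝ) : ℂ))

/-- The `j`-th classical Riesz transform of `f`, evaluated at `x`. -/
def riesz {n : ℕ} (j : Fin n) (f : EuclideanSpace ℝ (Fin n) → ℂ)
    (x : EuclideanSpace ℝ (Fin n)) : ℂ :=
  (rieszConst n : ℂ) *
    pvIntegral x (fun y => ((x j - y j : ℝ) : ℂ) * f y / ((‖x - y‖ ^ (n + 1) : ℝ) : ℂ))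

/-- The `j`-th linear canonical Riesz transform of `f`, evaluated at `x`, with parameters
`A = (A₁, …, Aₙ)`, where `Aₖ` is the real matrix `[aₖ, bₖ; cₖ, dₖ]` of determinant `1`, namely
`e_{b,-d}(x)` times the (normalized) Riesz singular integral of `f e_{b,a}`. It is used for
`bₖ ≠ 0`. -/
def lcrt {n : ℕ} (A : Fin n → SL(2, ℝ)) (j : Fin n) (f : EuclideanSpace ℝ (Fin n) → ℂ)
    (x : EuclideanSpace ℝ (Fin n)) : ℂ :=
  (rieszConst n : ℂ) * chirp (fun k => A k 0 1) (fun k => -(A k 1 1)) x *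
    pvIntegral x (fun y =>
      ((x j - y j : ℝ) : ℂ) * f y * chirp (fun k => A k 0 1) (fun k => A k 0 0) y /
        ((‖x - y‖ ^ (n + 1) : ℝ) : ℂ))

/-- The sharpness `b / c` of the matrix `[a, b; c, d]`. -/
def sharpness (M : SL(2, ℝ)) : ℝ := M 0 1 / M 1 0

open Classical in
/-- The class in `L^p` of a function in `L^p` (and `0` for other functions). -/
def lpClass {n : ℕ} (p : ℝ≥0∞) (h : EuclideanSpace ℝ (Fin n) → ℂ) :
    Lp ℂ p (volume : Measure (EuclideanSpace ℝ (Fin n))) :=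
  if H : MemLp h p volume then H.toLp h else 0

/-- The extension to `L^p`, by density of the Schwartz functions, of an operator `T` defined on
Schwartz functions: the value at `f` is the limit in `L^p` of `T g` as the Schwartz function `g`
tends to `f` in the `L^p` norm. -/
def lpExtend {n : ℕ} (p : ℝ≥0∞) [Fact (1 ≤ p)]
    (T : (EuclideanSpace ℝ (Fin n) → ℂ) → (EuclideanSpace ℝ (Fin n) → ℂ))
    (f : Lp ℂ p (volume : Measure (EuclideanSpace ℝ (Fin n)))) :
    Lp ℂ p (volume : Measure (EuclideanSpace ℝ (Fin n))) :=
  limUnder (comap (fun g : 𝓢(EuclideanSpace ℝ (Fin n), ℂ) => g.toLp p volume) (𝓝 f))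
    (fun g : 𝓢(EuclideanSpace ℝ (Fin n), ℂ) => lpClass p (T g))

/-- `lpExtend p T` is what it should be: a bounded linear operator on `L^p` that extends the action
of `T` on Schwartz functions. -/
def IsLpBounded {n : ℕ} (p : ℝ≥0∞) [Fact (1 ≤ p)]
    (T : (EuclideanSpace ℝ (Fin n) → ℂ) → (EuclideanSpace ℝ (Fin n) → ℂ)) : Prop :=
  ∃ S : Lp ℂ p (volume : Measure (EuclideanSpace ℝ (Fin n))) →L[ℂ]
      Lp ℂ p (volume : Measure (EuclideanSpace ℝ (Fin n))),
    (∀ f, lpExtend p T f = S f) ∧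
    ∀ g : 𝓢(EuclideanSpace ℝ (Fin n), ℂ), S (g.toLp p volume) =ᵐ[volume] T g

/-- The parameters `(A₁, A₂)` with `bₖ ≠ 0` and `cₖ ≠ 0` for `k = 1, 2`. -/
def Admissible (A : Fin 2 → SL(2, ℝ)) : Prop := ∀ k, A k 0 1 ≠ 0 ∧ A k 1 0 ≠ 0

/-- The mode of convergence `bₖ / cₖ → -1`, `aₖ → 0`, `dₖ → 0` (`k = 1, 2`), over all admissible
parameters `A = (A₁, A₂)`. -/
def sharpnessLimit : Filter (Fin 2 → SL(2, ℝ)) :=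
  comap (fun A k => (sharpness (A k), A k 0 0, A k 1 1)) (𝓝 fun _ : Fin 2 => ((-1 : ℝ), 0, 0)) ⊓
    𝓟 {A | Admissible A}

end

/-!
The linear canonical Riesz transform of a Schwartz function `f` is the classical Riesz transform
conjugated by chirps: `f` is multiplied by `exp (i ∑ₖ aₖ / (2 bₖ) yₖ²)`, the Riesz transform is
applied, and the result is multiplied by `exp (-i ∑ₖ dₖ / (2 bₖ) xₖ²)`. Rewriting through the
sharpness is the identity `(b / c) c = b`. In the limit considered, `b ^ 2 = (b / c) (a d - 1)`
tends to `1`, so the parameters `a / (2 b)` and `d / (2 b)` of the chirps tend to `0`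
(`tendsto_chirpParam`), and what has to be proved is the continuity of
`(α, β) ↦ (chirp of β) · R (f · chirp of α)` at `0`.

The principal value is an absolutely convergent integral once the odd kernel is symmetrized:
`R f (x) = c ∫ ½ (y_j / ‖y‖ ^ 3) (f (x - y) - f (x + y)) dy` (`isPV_regRiesz`). The symmetric
difference is dominated by a multiple of `‖y‖ (1 + ‖y‖) ^ (-3)`, uniformly for bounded chirp
parameters, so pointwise convergence is dominated convergence (`tendsto_chirpRiesz`).

For the convergence in `L^p`, multiplication by a chirp is an isometry, so the operators are
uniformly bounded as soon as the Riesz transform is bounded on `L^p`; then it suffices to treat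
Schwartz functions (`tendsto_norm_sub_of_dense`), for which the difference splits into
`(chirp of β) · R (f (chirp of α - 1))` and `(chirp of β - 1) · R f`, and both tend to `0` by
dominated convergence (`tendsto_eLpNorm_chirpRiesz_sub`). Convergence of tempered distributions
follows since `L^p` embeds continuously.

The boundedness of the Riesz transform for all `1 < p < ∞` is obtained without Fourier analysis or
interpolation. The kernel is replaced by `y_j / (‖y‖ (‖y‖ ^ 2 + ε ^ 2))`, with bounds uniform in
`ε`; Fatou's lemma removes the regularization (`exists_lintegral_regRiesz_zero_le`). Polar
coordinates turn the regularized operator into an average over directions of one-dimensional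
convolutions with `r / (r ^ 2 + ε ^ 2)` (the method of rotations, `regRiesz_eq`), and on the line
the bound is M. Riesz' theorem (`exists_lintegral_conjPoisson_conv_le`). For `f ≥ 0` and
`1 < p ≤ 2` it is proved with the Cauchy transform `F = u + i v` of `f` on the upper half plane:
`u > 0`, so `F ^ p` is holomorphic, its integral over horizontal lines vanishes
(`integral_horizontal_eq_zero`), and `|v| ^ p ≤ A u ^ p - B Re F ^ p` (`exists_abs_im_rpow_le`)
leaves only the Poisson integral `u`, which is controlled by Jensen's inequality. The case `p ≥ 2`
is dual (`exists_lintegral_regHilbert_le_of_two_le`).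
-/

/-! ### A trigonometric inequality, contour shifts, and the Cauchy transform -/

/-- The trigonometric inequality behind M. Riesz' theorem. Near `|θ| = π / 2` the term
`-cos (p θ)` is bounded below; elsewhere `cos θ` is. -/
theorem exists_abs_sin_rpow_le {p : ℝ} (hp1 : 1 < p) (hp2 : p ≤ 2) :
    ∃ A B : ℝ, 0 ≤ A ∧ ∀ θ : ℝ, |θ| < Real.pi / 2 →
      |Real.sin θ| ^ p ≤ A * Real.cos θ ^ p - B * Real.cos (θ * p) := by
  have hπ := Real.pi_pos
  set θ₀ : ℝ := Real.pi / 2 * ((p + 1) / (2 * p)) with hθ₀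
  have hpθ₀ : p * θ₀ = Real.pi / 2 * ((p + 1) / 2) := by rw [hθ₀]; field_simp
  have h1 : Real.pi / 2 < p * θ₀ := by rw [hpθ₀]; nlinarith
  have hθ₀pos : 0 < θ₀ := by positivity
  have hθ₀lt : θ₀ < Real.pi / 2 := by
    have : (p + 1) / (2 * p) < 1 := by rw [div_lt_one (by positivity)]; linarith
    rw [hθ₀]; nlinarith
  have hδ : Real.cos (p * θ₀) < 0 := by
    apply Real.cos_neg_of_pi_div_two_lt_of_lt h1
    nlinarith
  set δ : ℝ := -Real.cos (p * θ₀) with hδdef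
  have hδpos : 0 < δ := by simpa [hδdef] using hδ
  have hc0 : 0 < Real.cos θ₀ := Real.cos_pos_of_mem_Ioo ⟨by linarith, hθ₀lt⟩
  have hc0p : 0 < Real.cos θ₀ ^ p := Real.rpow_pos_of_pos hc0 p
  refine ⟨(1 + 1 / δ) / Real.cos θ₀ ^ p, 1 / δ, by positivity, fun θ hθ => ?_⟩
  have hsin : |Real.sin θ| ^ p ≤ 1 :=
    Real.rpow_le_one (abs_nonneg _) (Real.abs_sin_le_one θ) (by linarith)
  have hcos : 0 < Real.cos θ := Real.cos_pos_of_mem_Ioo (abs_lt.1 hθ)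
  have hcosp : 0 < Real.cos θ ^ p := Real.rpow_pos_of_pos hcos p
  rcases le_or_gt θ₀ |θ| with h | h
  · have hle : Real.cos (θ * p) ≤ -δ := by
      have : Real.cos (θ * p) = Real.cos (p * |θ|) := by
        rw [← Real.cos_abs, abs_mul, abs_of_pos (by linarith : 0 < p), mul_comm]
      rw [this, hδdef, neg_neg]
      apply Real.cos_le_cos_of_nonneg_of_le_pi (by positivity)
      · nlinarith
      · gcongr
    have : 1 ≤ -(1 / δ * Real.cos (θ * p)) := by
      rw [← mul_neg, div_mul_eq_mul_div, one_mul, one_le_div hδpos]; linarith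
    have : 0 ≤ (1 + 1 / δ) / Real.cos θ₀ ^ p * Real.cos θ ^ p := by positivity
    linarith
  · have hle : Real.cos θ₀ ^ p ≤ Real.cos θ ^ p := by
      apply Real.rpow_le_rpow hc0.le _ (by linarith)
      rw [← Real.cos_abs θ]
      exact Real.cos_le_cos_of_nonneg_of_le_pi (abs_nonneg _) (by linarith) h.le
    have h2 : 1 + 1 / δ ≤ (1 + 1 / δ) / Real.cos θ₀ ^ p * Real.cos θ ^ p := by
      rw [div_mul_eq_mul_div, le_div_iff₀ hc0p]; gcongr
    have h3 : 1 / δ * Real.cos (θ * p) ≤ 1 / δ := by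
      have := Real.cos_le_one (θ * p)
      have h4 : 0 < 1 / δ := by positivity
      nlinarith
    linarith

/-- The value of `z ^ p` has real part `‖z‖ ^ p cos (p arg z)`, so this is the homogeneous form of
the trigonometric inequality. -/
theorem exists_abs_im_rpow_le {p : ℝ} (hp1 : 1 < p) (hp2 : p ≤ 2) :
    ∃ A B : ℝ, 0 ≤ A ∧ ∀ z : ℂ, 0 < z.re →
      |z.im| ^ p ≤ A * z.re ^ p - B * (z ^ (p : ℂ)).re := by
  obtain ⟨A, B, hA, h⟩ := exists_abs_sin_rpow_le hp1 hp2
  refine ⟨A, B, hA, fun z hz => ?_⟩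
  have harg : |Complex.arg z| < Real.pi / 2 := Complex.abs_arg_lt_pi_div_two_iff.2 (Or.inl hz)
  have hcos : 0 < Real.cos z.arg := Real.cos_pos_of_mem_Ioo (abs_lt.1 harg)
  have hre : z.re = ‖z‖ * Real.cos z.arg := (Complex.norm_mul_cos_arg z).symm
  have him : z.im = ‖z‖ * Real.sin z.arg := (Complex.norm_mul_sin_arg z).symm
  rw [Complex.cpow_ofReal_re]
  nth_rewrite 1 [him]
  nth_rewrite 1 [hre]
  rw [abs_mul, abs_of_nonneg (norm_nonneg z), Real.mul_rpow (norm_nonneg _) (abs_nonneg _),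
    Real.mul_rpow (norm_nonneg _) hcos.le]
  have := mul_le_mul_of_nonneg_left (h _ harg) (Real.rpow_nonneg (norm_nonneg z) p)
  linarith

/-- A holomorphic function on the upper half plane which decays like `‖z‖ ^ (-p)`, `p > 1`, has
integral zero over horizontal lines: shift the contour to infinity. -/
theorem integral_horizontal_eq_zero {G : ℂ → ℂ} {p ε C : ℝ} (hp : 1 < p) (hε : 0 < ε)
    (hG : DifferentiableOn ℂ G {z | 0 < z.im})
    (hC : ∀ z : ℂ, ε ≤ z.im → ‖G z‖ ≤ C * ‖z‖ ^ (-p))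
    (hint : Integrable fun x : ℝ => G (x + ε * Complex.I)) :
    ∫ x : ℝ, G (x + ε * Complex.I) = 0 := by
  have hC0 : 0 ≤ C := by
    have h := (norm_nonneg _).trans (hC (ε * Complex.I) (by simp))
    have h2 : 0 < ‖(ε : ℂ) * Complex.I‖ ^ (-p) := by
      apply Real.rpow_pos_of_pos; simp [hε.ne']
    exact nonneg_of_mul_nonneg_left h h2
  have hlim := intervalIntegral_tendsto_integral hint tendsto_neg_atTop_atBot tendsto_id
  refine tendsto_nhds_unique hlim ?_
  have hbound : ∀ R : ℝ, ε ≤ R →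
      ‖∫ x in (-R)..R, G (x + ε * Complex.I)‖ ≤ 4 * C * R ^ (1 - p) := by
    intro R hR
    have hR0 : 0 < R := hε.trans_le hR
    have hdec : ∀ z : ℂ, ε ≤ z.im → R ≤ ‖z‖ → ‖G z‖ ≤ C * R ^ (-p) := fun z hz hz' =>
      (hC z hz).trans (mul_le_mul_of_nonneg_left
        (Real.rpow_le_rpow_of_nonpos hR0 hz' (by linarith)) hC0)
    have hrect := Complex.integral_boundary_rect_eq_zero_of_differentiableOn G
      (⟨-R, ε⟩ : ℂ) ⟨R, R⟩ (hG.mono (by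
        intro z hz
        have := (Complex.mem_reProdIm.1 hz).2
        rw [Set.uIcc_of_le hR] at this
        exact hε.trans_le this.1))
    simp only at hrect
    have htop : ‖∫ x : ℝ in (-R)..R, G (x + (R : ℂ) * Complex.I)‖ ≤ C * R ^ (-p) * |R - -R| := by
      apply intervalIntegral.norm_integral_le_of_norm_le_const
      intro x _
      apply hdec _ (by simpa using hR)
      have := Complex.abs_im_le_norm (x + (R : ℂ) * Complex.I)
      simpa [abs_of_pos hR0] using this
    have hside : ∀ s : ℝ, |s| = R →
        ‖∫ y : ℝ in ε..R, G ((s : ℂ) + y * Complex.I)‖ ≤ C * R ^ (-p) * |R - ε| := by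
      intro s hs
      apply intervalIntegral.norm_integral_le_of_norm_le_const
      intro y hy
      rw [Set.uIoc_of_le hR] at hy
      apply hdec _ (by simpa using hy.1.le)
      have := Complex.abs_re_le_norm ((s : ℂ) + y * Complex.I)
      simpa [hs] using this
    have h1 := hside R (abs_of_pos hR0)
    have h2 := hside (-R) (by rw [abs_neg, abs_of_pos hR0])
    have heq : (∫ x : ℝ in (-R)..R, G (x + ε * Complex.I)) =
        (∫ x : ℝ in (-R)..R, G (x + (R : ℂ) * Complex.I)) -
        Complex.I • (∫ y : ℝ in ε..R, G ((R : ℂ) + y * Complex.I)) +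
        Complex.I • (∫ y : ℝ in ε..R, G (((-R : ℝ) : ℂ) + y * Complex.I)) := by
      linear_combination hrect
    have hRp : R ^ (1 - p) = R * R ^ (-p) := by
      rw [sub_eq_add_neg, Real.rpow_add hR0, Real.rpow_one]
    have hRR : |R - -R| = 2 * R := by rw [abs_of_nonneg] <;> linarith
    have hRε : |R - ε| ≤ R := by rw [abs_of_nonneg] <;> linarith
    have hnn : 0 ≤ C * R ^ (-p) := mul_nonneg hC0 (Real.rpow_nonneg hR0.le _)
    rw [heq]
    refine (norm_add_le _ _).trans ((add_le_add_left (norm_sub_le _ _) _).trans ?_)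
    rw [norm_smul, norm_smul, Complex.norm_I, one_mul, one_mul, hRp]
    rw [hRR] at htop
    have := mul_le_mul_of_nonneg_left hRε hnn
    linarith
  refine squeeze_zero_norm' ((eventually_ge_atTop ε).mono fun R hR => hbound R hR) ?_
  have := (tendsto_rpow_neg_atTop (by linarith : 0 < p - 1)).const_mul (4 * C)
  simpa using this

/-- The Cauchy transform `∫ f(t) i / (z - t) dt` of a function on the line; its real and imaginary
parts are `π` times the Poisson integral and the conjugate Poisson integral of `f`. -/
noncomputable def cauchyTransform (f : ℝ → ℝ) (z : ℂ) : ℂ :=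
  ∫ t : ℝ, (f t : ℂ) * (Complex.I / (z - t))

theorem im_le_norm_sub_ofReal {z : ℂ} (t : ℝ) : z.im ≤ ‖z - t‖ := by
  simpa using (le_abs_self _).trans (Complex.abs_im_le_norm (z - t))

theorem integrable_cauchyTransform {f : ℝ → ℝ} (hf : Integrable f) {z : ℂ} (hz : 0 < z.im) :
    Integrable fun t : ℝ => (f t : ℂ) * (Complex.I / (z - t)) := by
  refine (hf.norm.mul_const (1 / z.im)).mono' ?_ (ae_of_all _ fun t => ?_)
  · exact (Complex.continuous_ofReal.comp_aestronglyMeasurable hf.1).mul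
      (Measurable.aestronglyMeasurable (by fun_prop))
  · rw [norm_mul, norm_div, Complex.norm_I, Complex.norm_real]
    gcongr
    exact im_le_norm_sub_ofReal t

theorem differentiableOn_cauchyTransform {f : ℝ → ℝ} (hf : Integrable f) :
    DifferentiableOn ℂ (cauchyTransform f) {z | 0 < z.im} := by
  intro z hz
  have hz' : 0 < z.im := hz
  apply DifferentiableAt.differentiableWithinAt
  have hs : {w : ℂ | z.im / 2 < w.im} ∈ 𝓝 z :=
    (isOpen_lt continuous_const Complex.continuous_im).mem_nhds (by simpa using hz')
  have key := hasDerivAt_integral_of_dominated_loc_of_deriv_le (𝕜 := ℂ) (μ := volume)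
    (F := fun (w : ℂ) (t : ℝ) => (f t : ℂ) * (Complex.I / (w - t)))
    (F' := fun (w : ℂ) (t : ℝ) => (f t : ℂ) * (-Complex.I / (w - t) ^ 2))
    (bound := fun t => ‖f t‖ * (1 / (z.im / 2) ^ 2)) hs ?_ (integrable_cauchyTransform hf hz') ?_ ?_
    (hf.norm.mul_const _) ?_
  · exact key.2.differentiableAt
  · filter_upwards [hs] with w hw
    exact (integrable_cauchyTransform hf (lt_trans (by linarith) hw)).1
  · exact (Complex.continuous_ofReal.comp_aestronglyMeasurable hf.1).mul
      (Measurable.aestronglyMeasurable (by fun_prop))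
  · refine ae_of_all _ fun t w hw => ?_
    rw [norm_mul, norm_div, norm_neg, Complex.norm_I, Complex.norm_real, norm_pow]
    gcongr
    exact (le_of_lt hw).trans (im_le_norm_sub_ofReal t)
  · refine ae_of_all _ fun t w hw => ?_
    have hne : w - t ≠ 0 := by
      intro h
      have h1 := im_le_norm_sub_ofReal (z := w) t
      rw [h, norm_zero] at h1
      have : z.im / 2 < w.im := hw
      linarith
    have := ((hasDerivAt_const w Complex.I).div ((hasDerivAt_id w).sub_const (t : ℂ)) hne).const_mul
      (f t : ℂ)
    simpa using this

/-- A first moment of `f` gives the decay `‖z‖⁻¹` above every horizontal line. -/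
theorem norm_cauchyTransform_le {f : ℝ → ℝ} (hf : Integrable f)
    (hf' : Integrable fun t => t * f t) {ε : ℝ} (hε : 0 < ε) {z : ℂ} (hz : ε ≤ z.im) :
    ‖cauchyTransform f z‖ ≤ (∫ t, ‖f t‖ + 1 / ε * ‖t * f t‖) * ‖z‖⁻¹ := by
  have hz0 : 0 < ‖z‖ := norm_pos_iff.2 (by rintro rfl; simp at hz; linarith)
  rw [← div_eq_mul_inv, le_div_iff₀ hz0, mul_comm, ← norm_mul, cauchyTransform,
    ← integral_const_mul]
  refine norm_integral_le_of_norm_le (hf.norm.add (hf'.norm.const_mul _)) (ae_of_all _ fun t => ?_)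
  have h1 : ε ≤ ‖z - t‖ := hz.trans (im_le_norm_sub_ofReal t)
  have h2 : 0 < ‖z - t‖ := hε.trans_le h1
  have h3 : ‖z‖ ≤ ‖z - t‖ + |t| := by
    simpa using norm_add_le (z - t) (t : ℂ)
  rw [norm_mul, norm_mul, norm_div, Complex.norm_I, Complex.norm_real]
  have h4 : ‖z‖ * (1 / ‖z - t‖) ≤ 1 + 1 / ε * |t| := by
    rw [mul_one_div, div_le_iff₀ h2]
    have : |t| ≤ 1 / ε * |t| * ‖z - t‖ := by
      rw [mul_assoc, mul_comm, mul_one_div, le_div_iff₀ hε]; gcongr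
    linarith
  calc ‖z‖ * (‖f t‖ * (1 / ‖z - t‖)) = ‖f t‖ * (‖z‖ * (1 / ‖z - t‖)) := by ring
    _ ≤ ‖f t‖ * (1 + 1 / ε * |t|) := by gcongr
    _ = _ := by rw [norm_mul, Real.norm_eq_abs t]; ring

/-- The regularized Hilbert transform `∫ (x - t) / ((x - t)² + ε²) f(t) dt` (without the
factor `1 / π`), that is, `π` times the conjugate Poisson integral. -/
noncomputable def regHilbert (ε : ℝ) (f : ℝ → ℝ) (x : ℝ) : ℝ :=
  ∫ t, (x - t) / ((x - t) ^ 2 + ε ^ 2) * f t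

/-- On the line at height `ε`, the Cauchy kernel splits into the Poisson kernel and its
conjugate. -/
theorem I_div_sub_eq {ε : ℝ} (hε : 0 < ε) (x t : ℝ) :
    Complex.I / ((x : ℂ) + ε * Complex.I - t) =
      ((ε / ((x - t) ^ 2 + ε ^ 2) : ℝ) : ℂ) +
        ((((x - t) / ((x - t) ^ 2 + ε ^ 2)) : ℝ) : ℂ) * Complex.I := by
  have hne : ((x : ℂ) + ε * Complex.I - t) ≠ 0 := by
    intro h
    have := congrArg Complex.im h
    simp at this; exact hε.ne' this
  have hne2 : ((x - t) ^ 2 + ε ^ 2 : ℝ) ≠ 0 := by positivity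
  have hne3 : (((x : ℂ) - t) ^ 2 + ε ^ 2) ≠ 0 := by exact_mod_cast hne2
  rw [div_eq_iff hne]
  push_cast
  field_simp
  linear_combination (-(ε : ℂ) * (x - t)) * Complex.I_sq

theorem I_div_sub_re {ε : ℝ} (hε : 0 < ε) (x t : ℝ) :
    (Complex.I / ((x : ℂ) + ε * Complex.I - t)).re = ε / ((x - t) ^ 2 + ε ^ 2) := by
  rw [I_div_sub_eq hε, Complex.add_re, Complex.re_ofReal_mul, Complex.ofReal_re, Complex.I_re,
    mul_zero, add_zero]

theorem I_div_sub_im {ε : ℝ} (hε : 0 < ε) (x t : ℝ) :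
    (Complex.I / ((x : ℂ) + ε * Complex.I - t)).im = (x - t) / ((x - t) ^ 2 + ε ^ 2) := by
  rw [I_div_sub_eq hε, Complex.add_im, Complex.im_ofReal_mul, Complex.ofReal_im, Complex.I_im,
    mul_one, zero_add]

theorem cauchyTransform_re {f : ℝ → ℝ} (hf : Integrable f) {ε : ℝ} (hε : 0 < ε) (x : ℝ) :
    (cauchyTransform f (x + ε * Complex.I)).re = ∫ t, ε / ((x - t) ^ 2 + ε ^ 2) * f t := by
  have hi := integrable_cauchyTransform hf (z := (x + ε * Complex.I)) (by simpa using hε)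
  rw [cauchyTransform, ← RCLike.re_eq_complex_re, ← integral_re hi]
  congr 1; ext t
  rw [RCLike.re_eq_complex_re, Complex.re_ofReal_mul, I_div_sub_re hε, mul_comm]

theorem cauchyTransform_im {f : ℝ → ℝ} (hf : Integrable f) {ε : ℝ} (hε : 0 < ε) (x : ℝ) :
    (cauchyTransform f (x + ε * Complex.I)).im = regHilbert ε f x := by
  have hi := integrable_cauchyTransform hf (z := (x + ε * Complex.I)) (by simpa using hε)
  rw [cauchyTransform, ← RCLike.im_eq_complex_im, ← integral_im hi, regHilbert]
  congr 1; ext t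
  rw [RCLike.im_eq_complex_im, Complex.im_ofReal_mul, I_div_sub_im hε, mul_comm]

theorem cauchyTransform_re_pos {f : ℝ → ℝ} (hf : Integrable f) (hf0 : 0 ≤ f)
    (hne : ¬ f =ᵐ[volume] 0) {z : ℂ} (hz : 0 < z.im) : 0 < (cauchyTransform f z).re := by
  have hz' : z = z.re + z.im * Complex.I := (Complex.re_add_im z).symm
  have hi := (integrable_cauchyTransform hf hz).re
  rw [hz', cauchyTransform_re hf hz]
  have hk : ∀ t, 0 < z.im / ((z.re - t) ^ 2 + z.im ^ 2) := fun t => by positivity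
  have hi' : Integrable fun t => z.im / ((z.re - t) ^ 2 + z.im ^ 2) * f t := by
    refine hi.congr (ae_of_all _ fun t => ?_)
    have hkt := I_div_sub_re hz z.re t
    rw [Complex.re_add_im] at hkt
    simp only [RCLike.re_eq_complex_re, Complex.re_ofReal_mul, hkt, mul_comm]
  rw [integral_pos_iff_support_of_nonneg (fun t => mul_nonneg (hk t).le (hf0 t)) hi']
  have hs : Function.support (fun t => z.im / ((z.re - t) ^ 2 + z.im ^ 2) * f t) =
      Function.support f := by
    ext t; rw [Function.mem_support, Function.mem_support, mul_ne_zero_iff_left (hk t).ne']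
  rw [hs]
  rw [pos_iff_ne_zero]
  intro h
  exact hne ((Filter.eventuallyEq_iff_exists_mem).2 ⟨(Function.support f)ᶜ,
    by rw [mem_ae_iff, compl_compl]; exact h, fun t ht => by simpa using ht⟩)

/-! ### M. Riesz' inequality for nonnegative functions -/

/-- Jensen's inequality for a finite measure, in the form given by Hölder's inequality. -/
theorem rpow_lintegral_le {α : Type*} [MeasurableSpace α] (μ : Measure α) {p : ℝ} (hp : 1 < p)
    {f : α → ℝ≥0∞} (hf : AEMeasurable f μ) :
    (∫⁻ a, f a ∂μ) ^ p ≤ μ Set.univ ^ (p - 1) * ∫⁻ a, f a ^ p ∂μ := by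
  have hpq := Real.HolderConjugate.conjExponent hp
  have h := ENNReal.lintegral_mul_le_Lp_mul_Lq μ hpq hf (aemeasurable_const (b := (1 : ℝ≥0∞)))
  simp only [Pi.mul_apply, mul_one, ENNReal.one_rpow, lintegral_const, one_mul] at h
  have hp0 : 0 < p := by linarith
  calc (∫⁻ a, f a ∂μ) ^ p
      ≤ ((∫⁻ a, f a ^ p ∂μ) ^ (1 / p) * μ Set.univ ^ (1 / p.conjExponent)) ^ p := by gcongr
    _ = _ := by
      rw [ENNReal.mul_rpow_of_nonneg _ _ hp0.le, ← ENNReal.rpow_mul, ← ENNReal.rpow_mul,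
        one_div_mul_cancel hp0.ne', ENNReal.rpow_one, mul_comm]
      congr 2
      rw [one_div_mul_eq_div, Real.conjExponent]
      field_simp

/-- The Poisson kernel is `π` times the density of a Cauchy distribution. -/
theorem lintegral_poisson {ε : ℝ} (hε : 0 < ε) (x : ℝ) :
    ∫⁻ t, ENNReal.ofReal (ε / ((x - t) ^ 2 + ε ^ 2)) = ENNReal.ofReal Real.pi := by
  have h := ProbabilityTheory.lintegral_cauchyPDF_eq_one x (γ := ε.toNNReal)
    (Real.toNNReal_pos.2 hε).ne'
  have h2 : ∀ t, ENNReal.ofReal (ε / ((x - t) ^ 2 + ε ^ 2)) =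
      ENNReal.ofReal Real.pi * ProbabilityTheory.cauchyPDF x ε.toNNReal t := by
    intro t
    rw [ProbabilityTheory.cauchyPDF_def, ProbabilityTheory.cauchyPDFReal_def,
      ← ENNReal.ofReal_mul Real.pi_pos.le]
    congr 1
    have : (x - t) ^ 2 + ε ^ 2 ≠ 0 := by positivity
    have h3 : (t - x) ^ 2 + ε ^ 2 ≠ 0 := by positivity
    have hπ := Real.pi_ne_zero
    rw [Real.coe_toNNReal _ hε.le]
    field_simp
    ring
  simp_rw [h2]
  rw [lintegral_const_mul _ (by fun_prop), h, mul_one]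

/-- Young's inequality for the convolution with the Poisson kernel. -/
theorem lintegral_poisson_rpow_le {p : ℝ} (hp : 1 < p) {ε : ℝ} (hε : 0 < ε) {f : ℝ → ℝ}
    (hf : AEStronglyMeasurable f) :
    ∫⁻ x, ‖∫ t, ε / ((x - t) ^ 2 + ε ^ 2) * f t‖ₑ ^ p ≤
      ENNReal.ofReal Real.pi ^ p * ∫⁻ t, ‖f t‖ₑ ^ p := by
  have hp0 : 0 < p := by linarith
  have hk : ∀ x t : ℝ, 0 ≤ ε / ((x - t) ^ 2 + ε ^ 2) := fun x t => by positivity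
  have hmeas : ∀ x, AEMeasurable (fun t => ENNReal.ofReal (ε / ((x - t) ^ 2 + ε ^ 2))) :=
    fun x => by fun_prop
  have hpt : ∀ x, ‖∫ t, ε / ((x - t) ^ 2 + ε ^ 2) * f t‖ₑ ^ p ≤ ENNReal.ofReal Real.pi ^ (p - 1) *
      ∫⁻ t, ENNReal.ofReal (ε / ((x - t) ^ 2 + ε ^ 2)) * ‖f t‖ₑ ^ p := by
    intro x
    set μ := (volume : Measure ℝ).withDensity
      fun t => ENNReal.ofReal (ε / ((x - t) ^ 2 + ε ^ 2)) with hμ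
    have hac : μ ≪ volume := withDensity_absolutelyContinuous _ _
    have hJ := rpow_lintegral_le μ hp (hf.enorm.mono_ac hac)
    rw [hμ, withDensity_apply _ MeasurableSet.univ, Measure.restrict_univ, lintegral_poisson hε,
      lintegral_withDensity_eq_lintegral_mul₀ (hmeas x) hf.enorm,
      lintegral_withDensity_eq_lintegral_mul₀ (hmeas x) (hf.enorm.pow_const p)] at hJ
    refine le_trans ?_ hJ
    gcongr
    refine (enorm_integral_le_lintegral_enorm _).trans_eq ?_
    congr 1; ext t
    rw [enorm_mul, Real.enorm_of_nonneg (hk x t), Pi.mul_apply]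
  calc ∫⁻ x, ‖∫ t, ε / ((x - t) ^ 2 + ε ^ 2) * f t‖ₑ ^ p
      ≤ ∫⁻ x, ENNReal.ofReal Real.pi ^ (p - 1) *
          ∫⁻ t, ENNReal.ofReal (ε / ((x - t) ^ 2 + ε ^ 2)) * ‖f t‖ₑ ^ p := lintegral_mono hpt
    _ = ENNReal.ofReal Real.pi ^ (p - 1) *
          ∫⁻ x, ∫⁻ t, ENNReal.ofReal (ε / ((x - t) ^ 2 + ε ^ 2)) * ‖f t‖ₑ ^ p := by
        rw [lintegral_const_mul' _ _ (ENNReal.rpow_ne_top_of_nonneg (by linarith)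
          ENNReal.ofReal_ne_top)]
    _ = ENNReal.ofReal Real.pi ^ (p - 1) *
          ∫⁻ t, ∫⁻ x, ENNReal.ofReal (ε / ((t - x) ^ 2 + ε ^ 2)) * ‖f t‖ₑ ^ p := by
        rw [lintegral_lintegral_swap]
        · congr 1
          refine lintegral_congr fun t => lintegral_congr fun x => ?_
          rw [← neg_sub t x, neg_sq]
        · refine AEMeasurable.mul (Measurable.aemeasurable (by fun_prop)) ?_
          exact (hf.enorm.pow_const p).comp_quasiMeasurePreserving
            Measure.quasiMeasurePreserving_snd
    _ = ENNReal.ofReal Real.pi ^ (p - 1) * ∫⁻ t, ENNReal.ofReal Real.pi * ‖f t‖ₑ ^ p := by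
        congr 1
        refine lintegral_congr fun t => ?_
        rw [lintegral_mul_const'' _ (hmeas t), lintegral_poisson hε]
    _ = _ := by
        rw [lintegral_const_mul' _ _ ENNReal.ofReal_ne_top, ← mul_assoc]
        congr 1
        conv_lhs => rw [← ENNReal.rpow_one (ENNReal.ofReal Real.pi), ← ENNReal.rpow_mul, one_mul]
        rw [← ENNReal.rpow_add _ _ (by simpa using Real.pi_pos) ENNReal.ofReal_ne_top]
        simp

/-- M. Riesz' inequality for nonnegative functions and `1 < p ≤ 2`. -/
theorem exists_lintegral_regHilbert_nonneg_le {p : ℝ} (hp1 : 1 < p) (hp2 : p ≤ 2) :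
    ∃ C : ℝ≥0∞, C ≠ ∞ ∧ ∀ ε : ℝ, 0 < ε → ∀ f : ℝ → ℝ, 0 ≤ f → Integrable f →
      Integrable (fun t => t * f t) →
        ∫⁻ x, ‖regHilbert ε f x‖ₑ ^ p ≤ C * ∫⁻ t, ‖f t‖ₑ ^ p := by
  obtain ⟨A, B, hA, hAB⟩ := exists_abs_im_rpow_le hp1 hp2
  have hp0 : 0 < p := by linarith
  refine ⟨ENNReal.ofReal A * ENNReal.ofReal Real.pi ^ p, ENNReal.mul_ne_top ENNReal.ofReal_ne_top
    (ENNReal.rpow_ne_top_of_nonneg hp0.le ENNReal.ofReal_ne_top), fun ε hε f hf0 hf hf' => ?_⟩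
  -- if `f` vanishes almost everywhere, `F = 0` is not in the slit plane, and the claim is trivial
  by_cases hne : f =ᵐ[volume] 0
  · have h0 : ∀ x, regHilbert ε f x = 0 := fun x => by
      rw [regHilbert, integral_eq_zero_of_ae]
      filter_upwards [hne] with t ht
      simp [ht]
    simp [h0, hp0]
  set F := cauchyTransform f with hF
  set ℓ : ℝ → ℂ := fun x => (x : ℂ) + ε * Complex.I with hℓ
  have hℓim : ∀ x, (ℓ x).im = ε := fun x => by simp [hℓ]
  have hℓc : Continuous ℓ := by fun_prop
  set M := ∫ t, ‖f t‖ + 1 / ε * ‖t * f t‖ with hM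
  have hM0 : 0 ≤ M := integral_nonneg fun t => by positivity
  have hFle : ∀ z : ℂ, ε ≤ z.im → ‖F z‖ ≤ M * ‖z‖⁻¹ := fun z hz =>
    norm_cauchyTransform_le hf hf' hε hz
  have hFpos : ∀ z : ℂ, 0 < z.im → 0 < (F z).re := fun z hz => cauchyTransform_re_pos hf hf0 hne hz
  have hFd : DifferentiableOn ℂ F {z | 0 < z.im} := differentiableOn_cauchyTransform hf
  have hGd : DifferentiableOn ℂ (fun z => F z ^ (p : ℂ)) {z | 0 < z.im} :=
    hFd.cpow_const fun z hz => Or.inl (hFpos z hz)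
  have hGle : ∀ z : ℂ, ε ≤ z.im → ‖F z ^ (p : ℂ)‖ ≤ M ^ p * ‖z‖ ^ (-p) := fun z hz => by
    rw [Complex.norm_cpow_real, Real.rpow_neg (norm_nonneg _), ← Real.inv_rpow (norm_nonneg _),
      ← Real.mul_rpow hM0 (inv_nonneg.2 (norm_nonneg _))]
    exact Real.rpow_le_rpow (norm_nonneg _) (hFle z hz) hp0.le
  have hmaps : ∀ x, ℓ x ∈ {z : ℂ | 0 < z.im} := fun x => by simp [hℓim, hε]
  have hFc : Continuous fun x => F (ℓ x) := hFd.continuousOn.comp_continuous hℓc hmaps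
  have hGc : Continuous fun x => F (ℓ x) ^ (p : ℂ) := hGd.continuousOn.comp_continuous hℓc hmaps
  -- `‖ℓ x‖ ^ (-p)` is integrable as `p > 1`
  have hdecay : Integrable fun x : ℝ => M ^ p * ‖ℓ x‖ ^ (-p) := by
    refine Integrable.const_mul ?_ _
    have h1 : Integrable fun x : ℝ => (1 + ‖x‖ ^ 2) ^ (-p / 2) :=
      integrable_rpow_neg_one_add_norm_sq (by simpa using hp1)
    refine (h1.const_mul (min 1 ε ^ (-p))).mono' (Continuous.aestronglyMeasurable
      (hℓc.norm.rpow_const fun x => Or.inl ?_)) (ae_of_all _ fun x => ?_)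
    · intro h
      have := hℓim x
      rw [norm_eq_zero.1 h] at this
      exact hε.ne this
    · have hm : 0 < min 1 ε := lt_min one_pos hε
      have hsq : ‖ℓ x‖ ^ 2 = x ^ 2 + ε ^ 2 := by
        rw [← Complex.normSq_eq_norm_sq, Complex.normSq_apply]; simp [hℓ]; ring
      have hle : min 1 ε * (1 + ‖x‖ ^ 2) ^ (1 / 2 : ℝ) ≤ ‖ℓ x‖ := by
        rw [← Real.sqrt_eq_rpow, ← Real.sqrt_sq (norm_nonneg (ℓ x)), ← Real.sqrt_sq hm.le,
          ← Real.sqrt_mul (sq_nonneg _), hsq]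
        apply Real.sqrt_le_sqrt
        have h1 : min 1 ε ^ 2 ≤ 1 := pow_le_one₀ hm.le (min_le_left _ _)
        have h2 : min 1 ε ^ 2 ≤ ε ^ 2 := by gcongr; exact min_le_right _ _
        rw [Real.norm_eq_abs, sq_abs]
        nlinarith [sq_nonneg x]
      rw [Real.norm_of_nonneg (Real.rpow_nonneg (norm_nonneg _) _)]
      calc ‖ℓ x‖ ^ (-p) ≤ (min 1 ε * (1 + ‖x‖ ^ 2) ^ (1 / 2 : ℝ)) ^ (-p) :=
            Real.rpow_le_rpow_of_nonpos (by positivity) hle (by linarith)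
        _ = _ := by
            rw [Real.mul_rpow hm.le (by positivity), ← Real.rpow_mul (by positivity)]
            congr 2; ring
  have hGint : Integrable fun x => F (ℓ x) ^ (p : ℂ) :=
    hdecay.mono' hGc.aestronglyMeasurable (ae_of_all _ fun x => hGle _ (hℓim x).ge)
  have hGzero : ∫ x, F (ℓ x) ^ (p : ℂ) = 0 :=
    integral_horizontal_eq_zero hp1 hε hGd hGle hGint
  have hu : ∀ x, 0 < (F (ℓ x)).re := fun x => hFpos _ (hmaps x)
  have huint : Integrable fun x => (F (ℓ x)).re ^ p := by
    refine hGint.norm.mono' (Continuous.aestronglyMeasurable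
      ((Complex.continuous_re.comp hFc).rpow_const fun x => Or.inr hp0.le))
      (ae_of_all _ fun x => ?_)
    rw [Real.norm_of_nonneg (Real.rpow_nonneg (hu x).le _), Complex.norm_cpow_real]
    exact Real.rpow_le_rpow (hu x).le ((le_abs_self _).trans (Complex.abs_re_le_norm _)) hp0.le
  have hrhs : Integrable fun x => A * (F (ℓ x)).re ^ p - B * (F (ℓ x) ^ (p : ℂ)).re :=
    (huint.const_mul A).sub (hGint.re.const_mul B)
  have hreint : ∫ x, (F (ℓ x) ^ (p : ℂ)).re = 0 := by
    have := integral_re hGint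
    simp only [RCLike.re_eq_complex_re] at this
    rw [this, hGzero, Complex.zero_re]
  calc ∫⁻ x, ‖regHilbert ε f x‖ₑ ^ p
      = ∫⁻ x, ENNReal.ofReal (|(F (ℓ x)).im| ^ p) := by
        refine lintegral_congr fun x => ?_
        rw [hF, hℓ, cauchyTransform_im hf hε, ← ENNReal.ofReal_rpow_of_nonneg (abs_nonneg _) hp0.le,
          Real.enorm_eq_ofReal_abs]
    _ ≤ ∫⁻ x, ENNReal.ofReal (A * (F (ℓ x)).re ^ p - B * (F (ℓ x) ^ (p : ℂ)).re) :=
        lintegral_mono fun x => ENNReal.ofReal_le_ofReal (hAB _ (hu x))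
    _ = ENNReal.ofReal (∫ x, A * (F (ℓ x)).re ^ p - B * (F (ℓ x) ^ (p : ℂ)).re) := by
        rw [ofReal_integral_eq_lintegral_ofReal hrhs (ae_of_all _ fun x =>
          (Real.rpow_nonneg (abs_nonneg _) p).trans (hAB _ (hu x)))]
    _ = ENNReal.ofReal A * ENNReal.ofReal (∫ x, (F (ℓ x)).re ^ p) := by
        have hB : Integrable fun x => B * (F (ℓ x) ^ (p : ℂ)).re := hGint.re.const_mul B
        rw [integral_sub (huint.const_mul A) hB, integral_const_mul, integral_const_mul,
          hreint, mul_zero, sub_zero, ENNReal.ofReal_mul hA]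
    _ = ENNReal.ofReal A * ∫⁻ x, ‖∫ t, ε / ((x - t) ^ 2 + ε ^ 2) * f t‖ₑ ^ p := by
        rw [ofReal_integral_eq_lintegral_ofReal huint (ae_of_all _ fun x =>
          Real.rpow_nonneg (hu x).le p)]
        congr 1
        refine lintegral_congr fun x => ?_
        rw [← cauchyTransform_re hf hε, ← ENNReal.ofReal_rpow_of_nonneg (hu x).le hp0.le,
          Real.enorm_of_nonneg (hu x).le]
    _ ≤ ENNReal.ofReal A * (ENNReal.ofReal Real.pi ^ p * ∫⁻ t, ‖f t‖ₑ ^ p) := by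
        gcongr
        exact lintegral_poisson_rpow_le hp1 hε hf.1
    _ = _ := by rw [mul_assoc]

/-! ### The regularized Hilbert transform on `L^p` -/

theorem abs_conjPoisson_le {ε : ℝ} (hε : 0 < ε) (r : ℝ) : |r / (r ^ 2 + ε ^ 2)| ≤ 1 / ε := by
  have h : 0 < r ^ 2 + ε ^ 2 := by positivity
  rw [abs_div, abs_of_pos h, div_le_div_iff₀ h hε, one_mul]
  nlinarith [sq_nonneg (|r| - ε), sq_abs r, abs_nonneg r]

theorem integrable_conjPoisson_mul {ε : ℝ} (hε : 0 < ε) {f : ℝ → ℝ} (hf : Integrable f) (x : ℝ) :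
    Integrable fun t => (x - t) / ((x - t) ^ 2 + ε ^ 2) * f t :=
  hf.bdd_mul (c := 1 / ε) (Measurable.aestronglyMeasurable (by fun_prop))
    (ae_of_all _ fun t => abs_conjPoisson_le hε _)

theorem continuous_regHilbert {ε : ℝ} (hε : 0 < ε) {f : ℝ → ℝ} (hf : Integrable f) :
    Continuous (regHilbert ε f) := by
  refine continuous_of_dominated (bound := fun t => 1 / ε * |f t|)
    (fun x => (integrable_conjPoisson_mul hε hf x).1) (fun x => ae_of_all _ fun t => ?_)
    (hf.norm.const_mul (1 / ε)) (ae_of_all _ fun t => ?_)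
  · rw [norm_mul]
    exact mul_le_mul_of_nonneg_right (abs_conjPoisson_le hε _) (norm_nonneg _)
  · refine Continuous.mul (Continuous.div (by fun_prop) (by fun_prop) fun x => ?_) continuous_const
    positivity

/-- M. Riesz' inequality for real functions and `1 < p ≤ 2`. -/
theorem exists_lintegral_regHilbert_le_of_le_two {p : ℝ} (hp1 : 1 < p) (hp2 : p ≤ 2) :
    ∃ C : ℝ≥0∞, C ≠ ∞ ∧ ∀ ε : ℝ, 0 < ε → ∀ f : ℝ → ℝ, Integrable f →
      Integrable (fun t => t * f t) →
        ∫⁻ x, ‖regHilbert ε f x‖ₑ ^ p ≤ C * ∫⁻ t, ‖f t‖ₑ ^ p := by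
  obtain ⟨C, hC, h⟩ := exists_lintegral_regHilbert_nonneg_le hp1 hp2
  have hp0 : 0 < p := by linarith
  have h2 : (2 : ℝ≥0∞) ^ (p - 1) ≠ ∞ := ENNReal.rpow_ne_top_of_nonneg (by linarith) (by simp)
  refine ⟨2 ^ (p - 1) * (C + C), ENNReal.mul_ne_top h2 (by simp [hC]), fun ε hε f hf hf' => ?_⟩
  have hpos : Integrable fun t => max (f t) 0 := by simpa using! hf.pos_part
  have hneg : Integrable fun t => max (-f t) 0 := by simpa using! hf.neg_part
  have hpos' : Integrable fun t => t * max (f t) 0 := by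
    refine hf'.mono (aestronglyMeasurable_id.mul hpos.1) (ae_of_all _ fun t => ?_)
    rw [norm_mul, norm_mul]
    gcongr
    rw [Real.norm_of_nonneg (le_max_right _ _)]
    exact max_le (le_abs_self _) (abs_nonneg _)
  have hneg' : Integrable fun t => t * max (-f t) 0 := by
    refine hf'.mono (aestronglyMeasurable_id.mul hneg.1) (ae_of_all _ fun t => ?_)
    rw [norm_mul, norm_mul]
    gcongr
    rw [Real.norm_of_nonneg (le_max_right _ _)]
    exact max_le (neg_le_abs _) (abs_nonneg _)
  have hsplit : ∀ x, regHilbert ε f x =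
      regHilbert ε (fun t => max (f t) 0) x - regHilbert ε (fun t => max (-f t) 0) x := fun x => by
    rw [regHilbert, regHilbert, regHilbert, ← integral_sub (integrable_conjPoisson_mul hε hpos x)
      (integrable_conjPoisson_mul hε hneg x)]
    congr 1; ext t
    rw [← mul_sub]
    congr 1
    rcases le_total 0 (f t) with h0 | h0
    · rw [max_eq_left h0, max_eq_right (by linarith), sub_zero]
    · rw [max_eq_right h0, max_eq_left (by linarith)]; ring
  calc ∫⁻ x, ‖regHilbert ε f x‖ₑ ^ p
      ≤ ∫⁻ x, 2 ^ (p - 1) * (‖regHilbert ε (fun t => max (f t) 0) x‖ₑ ^ p +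
          ‖regHilbert ε (fun t => max (-f t) 0) x‖ₑ ^ p) := by
        refine lintegral_mono fun x => ?_
        rw [hsplit]
        exact (ENNReal.rpow_le_rpow enorm_sub_le hp0.le).trans
          (ENNReal.rpow_add_le_mul_rpow_add_rpow _ _ hp1.le)
    _ = 2 ^ (p - 1) * ((∫⁻ x, ‖regHilbert ε (fun t => max (f t) 0) x‖ₑ ^ p) +
          ∫⁻ x, ‖regHilbert ε (fun t => max (-f t) 0) x‖ₑ ^ p) := by
        rw [lintegral_const_mul' _ _ h2, lintegral_add_left]
        exact (continuous_regHilbert hε hpos).measurable.enorm.pow_const p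
    _ ≤ 2 ^ (p - 1) * (C * (∫⁻ t, ‖f t‖ₑ ^ p) + C * (∫⁻ t, ‖f t‖ₑ ^ p)) := by
        gcongr
        · refine (h ε hε (fun t => max (f t) 0) (fun t => le_max_right _ _) hpos hpos').trans ?_
          gcongr with t
          rw [enorm_le_iff_norm_le, Real.norm_of_nonneg (le_max_right _ _)]
          exact max_le (le_abs_self _) (abs_nonneg _)
        · refine (h ε hε (fun t => max (-f t) 0) (fun t => le_max_right _ _) hneg hneg').trans ?_
          gcongr with t
          rw [enorm_le_iff_norm_le, Real.norm_of_nonneg (le_max_right _ _)]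
          exact max_le (neg_le_abs _) (abs_nonneg _)
    _ = _ := by ring

/-- The kernel is odd and bounded, so by Fubini the operator is antisymmetric. -/
theorem integral_regHilbert_mul {ε : ℝ} (hε : 0 < ε) {f h : ℝ → ℝ} (hf : Integrable f)
    (hh : Integrable h) :
    ∫ x, regHilbert ε f x * h x = -∫ t, f t * regHilbert ε h t := by
  have hint : Integrable
      (fun z : ℝ × ℝ => (z.1 - z.2) / ((z.1 - z.2) ^ 2 + ε ^ 2) * (h z.1 * f z.2))
      (volume.prod volume) :=
    (hh.mul_prod hf).bdd_mul (c := 1 / ε) (Measurable.aestronglyMeasurable (by fun_prop))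
      (ae_of_all _ fun z => abs_conjPoisson_le hε _)
  have hswap := integral_integral_swap (μ := volume) (ν := volume)
    (f := fun x t : ℝ => (x - t) / ((x - t) ^ 2 + ε ^ 2) * (h x * f t)) hint
  calc ∫ x, regHilbert ε f x * h x
      = ∫ x, ∫ t, (x - t) / ((x - t) ^ 2 + ε ^ 2) * (h x * f t) := by
        congr 1; ext x
        rw [regHilbert, ← integral_mul_const]
        congr 1; ext t; ring
    _ = ∫ t, ∫ x, (x - t) / ((x - t) ^ 2 + ε ^ 2) * (h x * f t) := hswap
    _ = _ := by
        rw [← integral_neg]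
        congr 1; ext t
        rw [regHilbert, ← integral_const_mul, ← integral_neg]
        congr 1; ext x
        rw [← neg_sub x t, neg_sq, neg_div]; ring

/-- M. Riesz' inequality for real functions and `2 ≤ p`, by duality with the exponent
`q = p / (p - 1) ≤ 2`: test `v = regHilbert ε f` against `|v| ^ (p - 2) * v` cut off to
`[-N, N]`. -/
theorem exists_lintegral_regHilbert_le_of_two_le {p : ℝ} (hp2 : 2 ≤ p) :
    ∃ C : ℝ≥0∞, C ≠ ∞ ∧ ∀ ε : ℝ, 0 < ε → ∀ f : ℝ → ℝ, Integrable f →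
        ∫⁻ x, ‖regHilbert ε f x‖ₑ ^ p ≤ C * ∫⁻ t, ‖f t‖ₑ ^ p := by
  have hp1 : 1 < p := by linarith
  have hp0 : 0 < p := by linarith
  have hpq := Real.HolderConjugate.conjExponent hp1
  set q := p.conjExponent with hq
  have hq1 : 1 < q := hpq.symm.lt
  have hq0 : 0 < q := by linarith
  have hqp : (p - 1) * q = p := by rw [hq, Real.conjExponent, mul_div_cancel₀ _ (by linarith)]
  have hq2 : q ≤ 2 := by
    rw [hq, Real.conjExponent, div_le_iff₀ (by linarith)]; linarith
  have hqinv : 1 / q * p = p - 1 := by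
    rw [one_div_mul_eq_div, div_eq_iff hq0.ne', hqp]
  obtain ⟨C, hC, hbd⟩ := exists_lintegral_regHilbert_le_of_le_two hq1 hq2
  refine ⟨C ^ (p - 1), ENNReal.rpow_ne_top_of_nonneg (by linarith) hC, fun ε hε f hf => ?_⟩
  set v := regHilbert ε f with hv
  have hvc : Continuous v := continuous_regHilbert hε hf
  have hcut : ∀ N : ℕ, ∫⁻ x in Set.Icc (-(N : ℝ)) N, ‖v x‖ₑ ^ p ≤
      C ^ (p - 1) * ∫⁻ t, ‖f t‖ₑ ^ p := by
    intro N
    set s := Set.Icc (-(N : ℝ)) N with hs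
    have hsm : MeasurableSet s := measurableSet_Icc
    set X := ∫⁻ x in s, ‖v x‖ₑ ^ p with hX
    set w : ℝ → ℝ := fun x => |v x| ^ (p - 2) * v x with hw
    have hwc : Continuous w :=
      ((continuous_abs.comp hvc).rpow_const fun x => Or.inr (by linarith)).mul hvc
    have hvw : ∀ x, v x * w x = |v x| ^ p := fun x => by
      rw [hw]
      rcases eq_or_ne (v x) 0 with h0 | h0
      · simp [h0, hp0.ne']
      · have : |v x| ^ p = |v x| ^ (p - 2) * |v x| ^ (2 : ℝ) := by
          rw [← Real.rpow_add (abs_pos.2 h0)]; congr 1; ring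
        rw [this, Real.rpow_two, sq_abs]; ring
    have hwq : ∀ x, ‖w x‖ₑ ^ q = ‖v x‖ₑ ^ p := fun x => by
      have h1 : ‖w x‖ = |v x| ^ (p - 1) := by
        rw [hw, norm_mul, Real.norm_of_nonneg (Real.rpow_nonneg (abs_nonneg _) _), Real.norm_eq_abs]
        rcases eq_or_ne (v x) 0 with h0 | h0
        · simp [h0, (by linarith : p - 1 ≠ 0)]
        · nth_rewrite 2 [← Real.rpow_one |v x|]
          rw [← Real.rpow_add (abs_pos.2 h0)]; congr 1; ring
      rw [← ofReal_norm, h1, Real.enorm_eq_ofReal_abs,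
        ENNReal.ofReal_rpow_of_nonneg (Real.rpow_nonneg (abs_nonneg _) _) hq0.le,
        ← Real.rpow_mul (abs_nonneg _), hqp, ENNReal.ofReal_rpow_of_nonneg (abs_nonneg _) hp0.le]
    set h : ℝ → ℝ := s.indicator w with hh
    have hint : Integrable h := (hwc.integrableOn_Icc).integrable_indicator hsm
    have hint' : Integrable fun t => t * h t := by
      have : (fun t => t * h t) = s.indicator fun t => t * w t := by
        ext t; by_cases ht : t ∈ s <;> simp [hh, ht]
      rw [this]
      exact ((continuous_id.mul hwc).integrableOn_Icc).integrable_indicator hsm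
    have hhq : ∫⁻ x, ‖h x‖ₑ ^ q = X := by
      rw [hX, ← lintegral_indicator hsm]
      refine lintegral_congr fun x => ?_
      by_cases hx : x ∈ s <;> simp [hh, hx, hwq, hq0]
    have hXint : IntegrableOn (fun x => |v x| ^ p) s :=
      (((continuous_abs.comp hvc).rpow_const fun x => Or.inr hp0.le)).integrableOn_Icc
    have hXeq : X = ENNReal.ofReal (∫ x in s, |v x| ^ p) := by
      rw [ofReal_integral_eq_lintegral_ofReal hXint (ae_of_all _ fun x => by positivity), hX]
      refine lintegral_congr fun x => ?_
      rw [Real.enorm_eq_ofReal_abs, ENNReal.ofReal_rpow_of_nonneg (abs_nonneg _) hp0.le]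
    have hXtop : X ≠ ∞ := by rw [hXeq]; exact ENNReal.ofReal_ne_top
    have hpair : ∫ x in s, |v x| ^ p = -∫ t, f t * regHilbert ε h t := by
      rw [← integral_regHilbert_mul hε hf hint, ← integral_indicator hsm]
      congr 1; ext x
      by_cases hx : x ∈ s <;> simp [hh, hx, ← hvw, ← hv]
    set Φ := ∫⁻ t, ‖f t‖ₑ ^ p with hΦ
    -- Hölder's inequality and the bound for the exponent `q`
    have hmain : X ≤ Φ ^ (1 / p) * (C * X) ^ (1 / q) := by
      calc X ≤ ‖∫ t, f t * regHilbert ε h t‖ₑ := by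
            rw [hXeq, hpair, ← enorm_neg (∫ t, f t * regHilbert ε h t), Real.enorm_eq_ofReal_abs]
            exact ENNReal.ofReal_le_ofReal (le_abs_self _)
        _ ≤ ∫⁻ t, ((fun t => ‖f t‖ₑ) * fun t => ‖regHilbert ε h t‖ₑ) t := by
            refine (enorm_integral_le_lintegral_enorm _).trans_eq ?_
            refine lintegral_congr fun t => ?_
            rw [enorm_mul, Pi.mul_apply]
        _ ≤ Φ ^ (1 / p) * (∫⁻ t, ‖regHilbert ε h t‖ₑ ^ q) ^ (1 / q) :=
            ENNReal.lintegral_mul_le_Lp_mul_Lq volume hpq hf.1.enorm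
              (continuous_regHilbert hε hint).measurable.enorm.aemeasurable
        _ ≤ Φ ^ (1 / p) * (C * X) ^ (1 / q) := by
            gcongr
            rw [← hhq]
            exact hbd ε hε h hint hint'
    -- `X ^ (p - 1)` can be cancelled, since the cut-off makes `X` finite
    rcases eq_or_ne X 0 with hX0 | hX0
    · rw [hX0]; exact zero_le
    have hpow : X ^ p ≤ Φ * (C ^ (p - 1) * X ^ (p - 1)) := by
      calc X ^ p ≤ (Φ ^ (1 / p) * (C * X) ^ (1 / q)) ^ p := by gcongr
        _ = _ := by
          rw [ENNReal.mul_rpow_of_nonneg _ _ hp0.le, ← ENNReal.rpow_mul, ← ENNReal.rpow_mul,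
            one_div_mul_cancel hp0.ne', ENNReal.rpow_one, hqinv,
            ENNReal.mul_rpow_of_nonneg _ _ (by linarith)]
    have hXp : X ^ p = X * X ^ (p - 1) := by
      conv_rhs => rw [← ENNReal.rpow_one X, ← ENNReal.rpow_mul, one_mul]
      rw [← ENNReal.rpow_add _ _ hX0 hXtop]; congr 1; ring
    rw [hXp, ← mul_assoc] at hpow
    rw [mul_comm (C ^ (p - 1))]
    exact (ENNReal.mul_le_mul_iff_left (by simp [hX0, hXtop])
      (ENNReal.rpow_ne_top_of_nonneg (by linarith) hXtop)).1 hpow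
  have hU : (⋃ N : ℕ, Set.Icc (-(N : ℝ)) N) = Set.univ := by
    refine Set.eq_univ_of_forall fun x => Set.mem_iUnion.2 ?_
    obtain ⟨N, hN⟩ := exists_nat_ge |x|
    exact ⟨N, abs_le.1 hN⟩
  have hmono : Monotone fun N : ℕ => Set.Icc (-(N : ℝ)) N := fun a b hab =>
    Set.Icc_subset_Icc (by simpa using hab) (by simpa using hab)
  rw [← setLIntegral_univ, ← hU, setLIntegral_iUnion_of_directed _ hmono.directed_le]
  exact iSup_le hcut

/-- **M. Riesz' theorem** for the regularized Hilbert transform of real functions. -/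
theorem exists_lintegral_regHilbert_le {p : ℝ} (hp1 : 1 < p) :
    ∃ C : ℝ≥0∞, C ≠ ∞ ∧ ∀ ε : ℝ, 0 < ε → ∀ f : ℝ → ℝ, Integrable f →
      Integrable (fun t => t * f t) →
        ∫⁻ x, ‖regHilbert ε f x‖ₑ ^ p ≤ C * ∫⁻ t, ‖f t‖ₑ ^ p := by
  rcases le_total p 2 with hp2 | hp2
  · exact exists_lintegral_regHilbert_le_of_le_two hp1 hp2
  · obtain ⟨C, hC, h⟩ := exists_lintegral_regHilbert_le_of_two_le hp2
    exact ⟨C, hC, fun ε hε f hf _ => h ε hε f hf⟩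

/-- M. Riesz' theorem for the regularized Hilbert transform of complex functions, written as a
convolution. -/
theorem exists_lintegral_conjPoisson_conv_le {p : ℝ} (hp1 : 1 < p) :
    ∃ C : ℝ≥0∞, C ≠ ∞ ∧ ∀ ε : ℝ, 0 < ε → ∀ f : ℝ → ℂ, Integrable f →
      Integrable (fun t : ℝ => (t : ℂ) * f t) →
        ∫⁻ x, ‖∫ r, ((r / (r ^ 2 + ε ^ 2) : ℝ) : ℂ) * f (x - r)‖ₑ ^ p ≤ C * ∫⁻ t, ‖f t‖ₑ ^ p := by
  obtain ⟨C, hC, h⟩ := exists_lintegral_regHilbert_le hp1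
  have hp0 : 0 < p := by linarith
  have h2 : (2 : ℝ≥0∞) ^ (p - 1) ≠ ∞ := ENNReal.rpow_ne_top_of_nonneg (by linarith) (by simp)
  refine ⟨2 ^ (p - 1) * (C + C), ENNReal.mul_ne_top h2 (by simp [hC]), fun ε hε f hf hf' => ?_⟩
  have hre : Integrable fun t => (f t).re := hf.re
  have him : Integrable fun t => (f t).im := hf.im
  have hre' : Integrable fun t => t * (f t).re := by simpa using hf'.re
  have him' : Integrable fun t => t * (f t).im := by simpa using hf'.im
  have hsplit : ∀ x, ∫ r, ((r / (r ^ 2 + ε ^ 2) : ℝ) : ℂ) * f (x - r) =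
      (regHilbert ε (fun t => (f t).re) x : ℂ) +
        Complex.I * (regHilbert ε (fun t => (f t).im) x : ℂ) := fun x => by
    have h1 : ∫ r, ((r / (r ^ 2 + ε ^ 2) : ℝ) : ℂ) * f (x - r) =
        ∫ t, (((x - t) / ((x - t) ^ 2 + ε ^ 2) : ℝ) : ℂ) * f t := by
      rw [← integral_sub_left_eq_self _ volume x]
      simp
    rw [h1, regHilbert, regHilbert, ← integral_complex_ofReal, ← integral_complex_ofReal,
      ← integral_const_mul, ← integral_add (integrable_conjPoisson_mul hε hre x).ofReal
        ((integrable_conjPoisson_mul hε him x).ofReal.const_mul _)]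
    congr 1; ext t
    nth_rewrite 1 [← Complex.re_add_im (f t)]
    push_cast; ring
  calc ∫⁻ x, ‖∫ r, ((r / (r ^ 2 + ε ^ 2) : ℝ) : ℂ) * f (x - r)‖ₑ ^ p
      ≤ ∫⁻ x, 2 ^ (p - 1) * (‖regHilbert ε (fun t => (f t).re) x‖ₑ ^ p +
          ‖regHilbert ε (fun t => (f t).im) x‖ₑ ^ p) := by
        refine lintegral_mono fun x => ?_
        rw [hsplit]
        refine (ENNReal.rpow_le_rpow (enorm_add_le _ _) hp0.le).trans
          ((ENNReal.rpow_add_le_mul_rpow_add_rpow _ _ hp1.le).trans_eq ?_)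
        have hI : ‖Complex.I‖ₑ = 1 := by rw [← ofReal_norm]; simp
        rw [enorm_mul, hI, one_mul, ← ofReal_norm, ← ofReal_norm, Complex.norm_real,
          Complex.norm_real, ofReal_norm, ofReal_norm]
    _ = 2 ^ (p - 1) * ((∫⁻ x, ‖regHilbert ε (fun t => (f t).re) x‖ₑ ^ p) +
          ∫⁻ x, ‖regHilbert ε (fun t => (f t).im) x‖ₑ ^ p) := by
        rw [lintegral_const_mul' _ _ h2, lintegral_add_left]
        exact (continuous_regHilbert hε hre).measurable.enorm.pow_const p
    _ ≤ 2 ^ (p - 1) * (C * (∫⁻ t, ‖f t‖ₑ ^ p) + C * (∫⁻ t, ‖f t‖ₑ ^ p)) := by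
        gcongr
        · refine (h ε hε _ hre hre').trans ?_
          gcongr with t
          rw [enorm_le_iff_norm_le]
          exact Complex.abs_re_le_norm _
        · refine (h ε hε _ him him').trans ?_
          gcongr with t
          rw [enorm_le_iff_norm_le]
          exact Complex.abs_im_le_norm _
    _ = _ := by ring

/-! ### The method of rotations -/

/-- The functions on the plane on which the singular integrals are evaluated: continuous, decaying
like `‖x‖⁻³`, and symmetrically Lipschitz at every point. The class contains the Schwartz
functions and is stable under multiplication by chirps. -/
structure IsTestFunction (f : EuclideanSpace ℝ (Fin 2) → ℂ) : Prop where
  continuous : Continuous f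
  decay : ∃ C : ℝ, ∀ x, ‖f x‖ ≤ C * (1 + ‖x‖) ^ (-3 : ℝ)
  symm_lipschitz : ∀ x, ∃ L : ℝ, ∀ y, ‖f (x - y) - f (x + y)‖ ≤ L * ‖y‖

/-- The unit vector of angle `θ`. -/
noncomputable def unitVec (θ : ℝ) : EuclideanSpace ℝ (Fin 2) :=
  Complex.orthonormalBasisOneI.repr (Real.cos θ + Real.sin θ * Complex.I)

/-- The coordinates `(s, t)` with respect to the orthonormal basis obtained by rotating the
standard basis by the angle `θ`. -/
noncomputable def rotCoord (θ : ℝ) (z : ℝ × ℝ) : EuclideanSpace ℝ (Fin 2) :=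
  Complex.orthonormalBasisOneI.repr
    (rotation (Circle.exp θ) (Complex.measurableEquivRealProd.symm z))

theorem measurePreserving_rotCoord (θ : ℝ) : MeasurePreserving (rotCoord θ) :=
  Complex.orthonormalBasisOneI.repr.measurePreserving.comp
    ((rotation (Circle.exp θ)).measurePreserving.comp
      Complex.volume_preserving_equiv_real_prod.symm)

theorem rotCoord_eq (θ s t : ℝ) : rotCoord θ (s, t) = Complex.orthonormalBasisOneI.repr
    ((Real.cos θ + Real.sin θ * Complex.I) * (s + t * Complex.I)) := by
  rw [rotCoord, rotation_apply, Circle.coe_exp, Complex.exp_mul_I,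
    Complex.measurableEquivRealProd_symm_apply, Complex.ofReal_cos, Complex.ofReal_sin,
    Complex.mk_eq_add_mul_I]

theorem continuous_unitVec : Continuous unitVec :=
  Complex.orthonormalBasisOneI.repr.continuous.comp (by fun_prop)

theorem norm_cos_add_sin_mul_I (θ : ℝ) : ‖(Real.cos θ + Real.sin θ * Complex.I : ℂ)‖ = 1 := by
  rw [Complex.ofReal_cos, Complex.ofReal_sin, Complex.norm_cos_add_sin_mul_I]

theorem norm_unitVec (θ : ℝ) : ‖unitVec θ‖ = 1 := by
  rw [unitVec, LinearIsometryEquiv.norm_map, norm_cos_add_sin_mul_I]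

theorem rotCoord_sub (θ s t r : ℝ) :
    rotCoord θ (s - r, t) = rotCoord θ (s, t) - r • unitVec θ := by
  rw [rotCoord_eq, rotCoord_eq, unitVec, ← LinearIsometryEquiv.map_smul,
    ← LinearIsometryEquiv.map_sub]
  congr 1
  rw [Complex.real_smul]; push_cast; ring

theorem abs_le_norm_rotCoord (θ s t : ℝ) : |s| ≤ ‖rotCoord θ (s, t)‖ := by
  rw [rotCoord_eq, LinearIsometryEquiv.norm_map, norm_mul, norm_cos_add_sin_mul_I, one_mul]
  simpa using Complex.abs_re_le_norm (s + t * Complex.I)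

theorem continuous_rotCoord (θ : ℝ) : Continuous (rotCoord θ) := by
  have : rotCoord θ = fun z : ℝ × ℝ => Complex.orthonormalBasisOneI.repr
    ((Real.cos θ + Real.sin θ * Complex.I) * (z.1 + z.2 * Complex.I)) := by
    ext1 z; exact rotCoord_eq θ z.1 z.2
  rw [this]
  exact Complex.orthonormalBasisOneI.repr.continuous.comp (by fun_prop)

/-- The regularized Hilbert transform in the direction `θ`, without the factor `1 / π`. -/
noncomputable def dirHilbert (ε : ℝ) (f : EuclideanSpace ℝ (Fin 2) → ℂ) (θ : ℝ)
    (x : EuclideanSpace ℝ (Fin 2)) : ℂ :=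
  ∫ r : ℝ, ((r / (r ^ 2 + ε ^ 2) : ℝ) : ℂ) * f (x - r • unitVec θ)

theorem measurable_dirHilbert (ε : ℝ) {f : EuclideanSpace ℝ (Fin 2) → ℂ} (hf : Continuous f) :
    Measurable fun z : EuclideanSpace ℝ (Fin 2) × ℝ => dirHilbert ε f z.2 z.1 := by
  refine StronglyMeasurable.measurable (StronglyMeasurable.integral_prod_right'
    (f := fun z : (EuclideanSpace ℝ (Fin 2) × ℝ) × ℝ =>
      ((z.2 / (z.2 ^ 2 + ε ^ 2) : ℝ) : ℂ) * f (z.1.1 - z.2 • unitVec z.1.2)) ?_)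
  refine Measurable.stronglyMeasurable (Measurable.mul (by fun_prop) (Continuous.measurable ?_))
  have := continuous_unitVec
  fun_prop

/-- Slicing the plane by the lines in the direction `θ`, the directional transforms inherit
M. Riesz' inequality, with a constant independent of `θ`. -/
theorem exists_lintegral_dirHilbert_le {p : ℝ} (hp1 : 1 < p) :
    ∃ C : ℝ≥0∞, C ≠ ∞ ∧ ∀ ε : ℝ, 0 < ε → ∀ f, IsTestFunction f → ∀ θ : ℝ,
      ∫⁻ x, ‖dirHilbert ε f θ x‖ₑ ^ p ≤ C * ∫⁻ x, ‖f x‖ₑ ^ p := by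
  obtain ⟨C, hC, h⟩ := exists_lintegral_conjPoisson_conv_le hp1
  refine ⟨C, hC, fun ε hε f hf θ => ?_⟩
  have hmeas : Measurable fun x => ‖dirHilbert ε f θ x‖ₑ ^ p :=
    ((measurable_dirHilbert ε hf.continuous).comp
      (measurable_id.prodMk measurable_const)).enorm.pow_const p
  have hfm : Measurable fun x => ‖f x‖ₑ ^ p := hf.continuous.measurable.enorm.pow_const p
  have hΦ := measurePreserving_rotCoord θ
  rw [← hΦ.lintegral_comp hmeas, ← hΦ.lintegral_comp hfm, Measure.volume_eq_prod,
    lintegral_prod_symm' (fun z => ‖dirHilbert ε f θ (rotCoord θ z)‖ₑ ^ p)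
      (hmeas.comp hΦ.measurable),
    lintegral_prod_symm' (fun z => ‖f (rotCoord θ z)‖ₑ ^ p) (hfm.comp hΦ.measurable),
    ← lintegral_const_mul' _ _ hC]
  refine lintegral_mono fun t => ?_
  obtain ⟨D, hD⟩ := hf.decay
  have hD0 : 0 ≤ D := by
    have := (norm_nonneg _).trans (hD 0); simpa using this
  set g : ℝ → ℂ := fun s => f (rotCoord θ (s, t)) with hg
  have hgc : Continuous g := hf.continuous.comp ((continuous_rotCoord θ).comp (by fun_prop))
  have hgle : ∀ s, ‖g s‖ ≤ D * (1 + ‖s‖) ^ (-3 : ℝ) := fun s => (hD _).trans <| by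
    refine mul_le_mul_of_nonneg_left
      (Real.rpow_le_rpow_of_nonpos (by positivity) ?_ (by norm_num)) hD0
    gcongr
    exact abs_le_norm_rotCoord θ s t
  have hint : Integrable g :=
    ((integrable_one_add_norm (E := ℝ) (r := 3) (by simp)).const_mul D).mono'
      hgc.aestronglyMeasurable (ae_of_all _ hgle)
  have hint' : Integrable fun s : ℝ => (s : ℂ) * g s := by
    refine ((integrable_one_add_norm (E := ℝ) (r := 2) (by simp)).const_mul D).mono'
      (Continuous.aestronglyMeasurable (by fun_prop)) (ae_of_all _ fun s => ?_)
    rw [norm_mul, Complex.norm_real]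
    have h1 : 0 < 1 + ‖s‖ := by positivity
    calc ‖s‖ * ‖g s‖ ≤ (1 + ‖s‖) * (D * (1 + ‖s‖) ^ (-3 : ℝ)) := by
          gcongr
          · linarith
          · exact hgle s
      _ = D * ((1 + ‖s‖) ^ (1 : ℝ) * (1 + ‖s‖) ^ (-3 : ℝ)) := by rw [Real.rpow_one]; ring
      _ = _ := by rw [← Real.rpow_add h1]; norm_num
  refine le_trans (le_of_eq ?_) (h ε hε g hint hint')
  refine lintegral_congr fun s => ?_
  simp only [dirHilbert, hg, rotCoord_sub]

/-- The regularized Riesz kernel. For `ε = 0` it is the Riesz kernel `y_j / ‖y‖ ^ 3` itself. -/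
noncomputable def regKernel (ε : ℝ) (j : Fin 2) (y : EuclideanSpace ℝ (Fin 2)) : ℝ :=
  y j / (‖y‖ * (‖y‖ ^ 2 + ε ^ 2))

theorem measurable_regKernel (ε : ℝ) (j : Fin 2) : Measurable (regKernel ε j) := by
  have : Measurable fun y : EuclideanSpace ℝ (Fin 2) => y j :=
    (EuclideanSpace.proj (𝕜 := ℝ) j).continuous.measurable
  unfold regKernel
  fun_prop

theorem abs_apply_le_norm (y : EuclideanSpace ℝ (Fin 2)) (j : Fin 2) : |y j| ≤ ‖y‖ :=
  PiLp.norm_apply_le y j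

theorem abs_regKernel_le (ε : ℝ) (j : Fin 2) (y : EuclideanSpace ℝ (Fin 2)) :
    |regKernel ε j y| ≤ (‖y‖ ^ 2)⁻¹ := by
  rcases eq_or_ne y 0 with rfl | hy
  · simp [regKernel]
  have hy0 : 0 < ‖y‖ := norm_pos_iff.2 hy
  rw [regKernel, abs_div, abs_of_nonneg (by positivity : 0 ≤ ‖y‖ * (‖y‖ ^ 2 + ε ^ 2)),
    div_le_iff₀ (by positivity)]
  have h1 := abs_apply_le_norm y j
  have h2 : (‖y‖ ^ 2)⁻¹ * (‖y‖ * (‖y‖ ^ 2 + ε ^ 2)) = ‖y‖ + ε ^ 2 / ‖y‖ := by field_simp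
  rw [h2]
  have : 0 ≤ ε ^ 2 / ‖y‖ := by positivity
  linarith

/-- A symmetric difference of a decaying function, once it is Lipschitz at the center, is
dominated by an integrable function after division by `‖y‖ ^ 2`. -/
theorem norm_symm_diff_le {f : EuclideanSpace ℝ (Fin 2) → ℂ} {C L : ℝ}
    (hC : ∀ x, ‖f x‖ ≤ C * (1 + ‖x‖) ^ (-3 : ℝ)) {x : EuclideanSpace ℝ (Fin 2)}
    (hL : ∀ y, ‖f (x - y) - f (x + y)‖ ≤ L * ‖y‖) (y : EuclideanSpace ℝ (Fin 2)) :
    ‖f (x - y) - f (x + y)‖ ≤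
      (8 * L + 2 * C * (1 + ‖x‖) ^ (3 : ℝ)) * (‖y‖ * (1 + ‖y‖) ^ (-3 : ℝ)) := by
  have hC0 : 0 ≤ C := by
    have := (norm_nonneg _).trans (hC 0); simpa using this
  have hy1 : 0 < 1 + ‖y‖ := by positivity
  have hx1 : 0 < 1 + ‖x‖ := by positivity
  have hd : 0 ≤ (1 + ‖y‖) ^ (-3 : ℝ) := by positivity
  have hCx : 0 ≤ C * (1 + ‖x‖) ^ (3 : ℝ) := by positivity
  have hL0 : 0 ≤ L * ‖y‖ := (norm_nonneg _).trans (hL y)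
  rcases le_total ‖y‖ 1 with h | h
  -- for `‖y‖ ≤ 1` the Lipschitz bound suffices, as `(1 + ‖y‖) ^ 3 ≤ 8`
  · have h8 : 1 ≤ 8 * (1 + ‖y‖) ^ (-3 : ℝ) := by
      rw [Real.rpow_neg hy1.le, ← div_eq_mul_inv, one_le_div (by positivity)]
      have : (1 + ‖y‖) ^ (3 : ℝ) ≤ 2 ^ (3 : ℝ) := by gcongr; linarith
      refine this.trans (by norm_num)
    have h9 : 0 ≤ 2 * C * (1 + ‖x‖) ^ (3 : ℝ) * (‖y‖ * (1 + ‖y‖) ^ (-3 : ℝ)) := by positivity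
    have := mul_le_mul_of_nonneg_left h8 hL0
    linarith [hL y]
  -- for `‖y‖ ≥ 1` both terms are small, as `1 + ‖y‖ ≤ (1 + ‖x‖) (1 + ‖x ± y‖)`
  · have hL0' : 0 ≤ L := nonneg_of_mul_nonneg_left hL0 (by linarith)
    have hone : ∀ w : EuclideanSpace ℝ (Fin 2), 1 + ‖y‖ ≤ (1 + ‖x‖) * (1 + ‖w‖) →
        ‖f w‖ ≤ C * (1 + ‖x‖) ^ (3 : ℝ) * (1 + ‖y‖) ^ (-3 : ℝ) := fun w hw => by
      refine (hC w).trans ?_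
      rw [mul_assoc]
      gcongr
      have hw1 : 0 < 1 + ‖w‖ := by positivity
      rw [Real.rpow_neg hw1.le, Real.rpow_neg hy1.le, ← div_eq_mul_inv,
        le_div_iff₀ (by positivity), inv_mul_le_iff₀ (by positivity),
        ← Real.mul_rpow hw1.le hx1.le, mul_comm (1 + ‖w‖)]
      exact Real.rpow_le_rpow hy1.le hw (by norm_num)
    have ha := hone (x - y) (by
      have := norm_sub_le x (x - y)
      rw [sub_sub_cancel] at this
      nlinarith [norm_nonneg x, norm_nonneg (x - y)])
    have hb := hone (x + y) (by
      have := norm_sub_le (x + y) x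
      rw [add_sub_cancel_left] at this
      nlinarith [norm_nonneg x, norm_nonneg (x + y)])
    refine (norm_sub_le _ _).trans ((add_le_add ha hb).trans ?_)
    have h1 : (1 + ‖y‖) ^ (-3 : ℝ) ≤ ‖y‖ * (1 + ‖y‖) ^ (-3 : ℝ) := le_mul_of_one_le_left hd h
    have h2 := mul_le_mul_of_nonneg_left h1 hCx
    have h3 : 0 ≤ 8 * L * (‖y‖ * (1 + ‖y‖) ^ (-3 : ℝ)) := by positivity
    linarith

/-- The function which dominates all the singular integrands. -/
theorem integrable_inv_norm_mul_rpow :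
    Integrable fun y : EuclideanSpace ℝ (Fin 2) =>
      (‖y‖ ^ 2)⁻¹ * (‖y‖ * (1 + ‖y‖) ^ (-3 : ℝ)) := by
  rw [integrable_fun_norm_addHaar volume (f := fun r : ℝ => (r ^ 2)⁻¹ * (r * (1 + r) ^ (-3 : ℝ)))]
  have h : IntegrableOn (fun r : ℝ => (1 + ‖r‖) ^ (-3 : ℝ)) (Set.Ioi 0) :=
    (integrable_one_add_norm (E := ℝ) (r := 3) (by simp)).integrableOn
  refine h.congr_fun (fun r hr => ?_) measurableSet_Ioi
  have hr0 : 0 < r := hr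
  simp only [finrank_euclideanSpace, Fintype.card_fin, smul_eq_mul, Real.norm_of_nonneg hr0.le]
  field_simp
  ring

theorem IsTestFunction.exists_symm_diff_le {f : EuclideanSpace ℝ (Fin 2) → ℂ}
    (hf : IsTestFunction f) (x : EuclideanSpace ℝ (Fin 2)) :
    ∃ M : ℝ, ∀ y, ‖f (x - y) - f (x + y)‖ ≤ M * (‖y‖ * (1 + ‖y‖) ^ (-3 : ℝ)) := by
  obtain ⟨C, hC⟩ := hf.decay
  obtain ⟨L, hL⟩ := hf.symm_lipschitz x
  exact ⟨_, norm_symm_diff_le hC hL⟩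

theorem norm_mul_symm_diff_le {k M : ℝ} {f : EuclideanSpace ℝ (Fin 2) → ℂ}
    {x y : EuclideanSpace ℝ (Fin 2)} (hk : |k| ≤ (‖y‖ ^ 2)⁻¹)
    (hM : ‖f (x - y) - f (x + y)‖ ≤ M * (‖y‖ * (1 + ‖y‖) ^ (-3 : ℝ))) :
    ‖(k : ℂ) * (f (x - y) - f (x + y))‖ ≤
      M * ((‖y‖ ^ 2)⁻¹ * (‖y‖ * (1 + ‖y‖) ^ (-3 : ℝ))) := by
  rw [norm_mul, Complex.norm_real]
  calc ‖k‖ * ‖f (x - y) - f (x + y)‖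
      ≤ (‖y‖ ^ 2)⁻¹ * (M * (‖y‖ * (1 + ‖y‖) ^ (-3 : ℝ))) := by gcongr; exact hk
    _ = _ := by ring

theorem IsTestFunction.integrable_mul_symm_diff {f : EuclideanSpace ℝ (Fin 2) → ℂ}
    (hf : IsTestFunction f) {k : EuclideanSpace ℝ (Fin 2) → ℝ} (hk : Measurable k)
    (hk' : ∀ y, |k y| ≤ (‖y‖ ^ 2)⁻¹) (x : EuclideanSpace ℝ (Fin 2)) :
    Integrable fun y => (k y : ℂ) * (f (x - y) - f (x + y)) := by
  obtain ⟨M, hM⟩ := hf.exists_symm_diff_le x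
  refine (integrable_inv_norm_mul_rpow.const_mul M).mono' ?_
    (ae_of_all _ fun y => norm_mul_symm_diff_le (hk' y) (hM y))
  have := hf.continuous
  exact ((Complex.measurable_ofReal.comp hk).mul
    (Continuous.measurable (by fun_prop))).aestronglyMeasurable

/-- The regularized Riesz transform, without its normalizing constant and symmetrized:
`½ ∫ k(y) (f(x - y) - f(x + y)) dy`. For a test function the integral converges absolutely, also
for `ε = 0`. -/
noncomputable def regRiesz (ε : ℝ) (j : Fin 2) (f : EuclideanSpace ℝ (Fin 2) → ℂ)
    (x : EuclideanSpace ℝ (Fin 2)) : ℂ :=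
  1 / 2 * ∫ y, (regKernel ε j y : ℂ) * (f (x - y) - f (x + y))

theorem measurable_integral_mul_symm_diff {f : EuclideanSpace ℝ (Fin 2) → ℂ} (hf : Continuous f)
    {k : EuclideanSpace ℝ (Fin 2) → ℝ} (hk : Measurable k) :
    Measurable fun x => ∫ y, (k y : ℂ) * (f (x - y) - f (x + y)) := by
  refine StronglyMeasurable.measurable (StronglyMeasurable.integral_prod_right'
    (f := fun z : EuclideanSpace ℝ (Fin 2) × EuclideanSpace ℝ (Fin 2) =>
      (k z.2 : ℂ) * (f (z.1 - z.2) - f (z.1 + z.2))) ?_)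
  exact (Measurable.mul (by fun_prop) (Continuous.measurable (by fun_prop))).stronglyMeasurable

theorem integrableOn_polar {F : ℂ → ℂ} (hF : Integrable F) (hm : Measurable F) :
    IntegrableOn (fun z : ℝ × ℝ => z.1 • F (Complex.polarCoord.symm z))
      (Set.Ioi 0 ×ˢ Set.Ioo (-Real.pi) Real.pi) := by
  have hms : MeasurableSet (Set.Ioi (0 : ℝ) ×ˢ Set.Ioo (-Real.pi) Real.pi) :=
    measurableSet_Ioi.prod measurableSet_Ioo
  refine ⟨Measurable.aestronglyMeasurable ?_, ?_⟩
  · have hp : Measurable Complex.polarCoord.symm := by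
      rw [show ⇑Complex.polarCoord.symm = _ from funext Complex.polarCoord_symm_apply]
      fun_prop
    exact measurable_fst.smul (hm.comp hp)
  · have h := Complex.lintegral_comp_polarCoord_symm fun z => ‖F z‖ₑ
    rw [HasFiniteIntegral]
    refine lt_of_eq_of_lt ?_ hF.2
    rw [← h]
    refine setLIntegral_congr_fun hms fun z hz => ?_
    rw [smul_eq_mul, enorm_smul, Real.enorm_of_nonneg (le_of_lt hz.1)]

theorem integrable_conjPoisson_slice {ε : ℝ} (hε : 0 < ε) {f : EuclideanSpace ℝ (Fin 2) → ℂ}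
    (hf : IsTestFunction f) (θ : ℝ) (x : EuclideanSpace ℝ (Fin 2)) :
    Integrable fun r : ℝ => ((r / (r ^ 2 + ε ^ 2) : ℝ) : ℂ) * f (x - r • unitVec θ) := by
  obtain ⟨C, hC⟩ := hf.decay
  have hC0 : 0 ≤ C := by
    have := (norm_nonneg _).trans (hC 0); simpa using this
  have hfc := hf.continuous
  have hi : Integrable fun r : ℝ => f (x - r • unitVec θ) := by
    refine ((integrable_one_add_norm (E := ℝ) (r := 3) (by simp)).const_mul
      (C * (1 + ‖x‖) ^ (3 : ℝ))).mono' (Continuous.aestronglyMeasurable (by fun_prop))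
      (ae_of_all _ fun r => (hC _).trans ?_)
    rw [mul_assoc]
    gcongr
    have h1 : ‖r‖ ≤ ‖x‖ + ‖x - r • unitVec θ‖ := by
      have := norm_sub_le x (x - r • unitVec θ)
      rwa [sub_sub_cancel, norm_smul, norm_unitVec, mul_one] at this
    have hw1 : 0 < 1 + ‖x - r • unitVec θ‖ := by positivity
    have hr1 : 0 < 1 + ‖r‖ := by positivity
    rw [Real.rpow_neg hw1.le, Real.rpow_neg hr1.le, ← div_eq_mul_inv,
      le_div_iff₀ (by positivity), inv_mul_le_iff₀ (by positivity),
      ← Real.mul_rpow hw1.le (by positivity)]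
    refine Real.rpow_le_rpow hr1.le ?_ (by norm_num)
    nlinarith [norm_nonneg x, norm_nonneg (x - r • unitVec θ)]
  refine hi.bdd_mul (c := 1 / ε) (Measurable.aestronglyMeasurable (by fun_prop))
    (ae_of_all _ fun r => ?_)
  rw [Complex.norm_real]
  exact abs_conjPoisson_le hε r

/-- The method of rotations: in polar coordinates the regularized Riesz transform is an average of
directional Hilbert transforms. -/
theorem regRiesz_eq {ε : ℝ} (hε : 0 < ε) (j : Fin 2) {f : EuclideanSpace ℝ (Fin 2) → ℂ}
    (hf : IsTestFunction f) (x : EuclideanSpace ℝ (Fin 2)) :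
    regRiesz ε j f x =
      1 / 2 * ∫ θ in Set.Ioo (-Real.pi) Real.pi, (unitVec θ j : ℂ) * dirHilbert ε f θ x := by
  rw [regRiesz]
  congr 1
  set F : EuclideanSpace ℝ (Fin 2) → ℂ :=
    fun y => (regKernel ε j y : ℂ) * (f (x - y) - f (x + y)) with hF
  have hfc := hf.continuous
  have hFi : Integrable F :=
    hf.integrable_mul_symm_diff (measurable_regKernel ε j) (abs_regKernel_le ε j) x
  have hFm : Measurable F := (Complex.measurable_ofReal.comp (measurable_regKernel ε j)).mul
    (Continuous.measurable (by fun_prop))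
  have hmp := Complex.orthonormalBasisOneI.repr.measurePreserving
  have hme := Complex.orthonormalBasisOneI.repr.toHomeomorph.measurableEmbedding
  have hFi' : Integrable fun z : ℂ => F (Complex.orthonormalBasisOneI.repr z) :=
    hmp.integrable_comp_of_integrable hFi
  have hpol := integrableOn_polar hFi' (hFm.comp hmp.measurable)
  have hswap : IntegrableOn (fun z : ℝ × ℝ => z.2 • F (Complex.orthonormalBasisOneI.repr
      (Complex.polarCoord.symm z.swap))) (Set.Ioo (-Real.pi) Real.pi ×ˢ Set.Ioi 0)
      (volume.prod volume) := hpol.swap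
  calc ∫ y, F y = ∫ z : ℂ, F (Complex.orthonormalBasisOneI.repr z) := by
        rw [← hmp.integral_comp hme]
    _ = ∫ z in Set.Ioi (0 : ℝ) ×ˢ Set.Ioo (-Real.pi) Real.pi,
          z.1 • F (Complex.orthonormalBasisOneI.repr (Complex.polarCoord.symm z)) := by
        rw [← Complex.integral_comp_polarCoord_symm]; rfl
    _ = ∫ z in Set.Ioo (-Real.pi) Real.pi ×ˢ Set.Ioi (0 : ℝ),
          z.2 • F (Complex.orthonormalBasisOneI.repr (Complex.polarCoord.symm z.swap)) := by
        rw [Measure.volume_eq_prod, ← setIntegral_prod_swap]; rfl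
    _ = ∫ θ in Set.Ioo (-Real.pi) Real.pi, ∫ r in Set.Ioi (0 : ℝ),
          r • F (Complex.orthonormalBasisOneI.repr (Complex.polarCoord.symm (r, θ))) := by
        rw [Measure.volume_eq_prod, setIntegral_prod _ hswap]; rfl
    _ = _ := by
        refine setIntegral_congr_fun measurableSet_Ioo fun θ _ => ?_
        have hpt : ∀ r ∈ Set.Ioi (0 : ℝ),
            r • F (Complex.orthonormalBasisOneI.repr (Complex.polarCoord.symm (r, θ))) =
            (unitVec θ j : ℂ) * (((r / (r ^ 2 + ε ^ 2) : ℝ) : ℂ) * f (x - r • unitVec θ) +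
              (((-r) / ((-r) ^ 2 + ε ^ 2) : ℝ) : ℂ) * f (x - (-r) • unitVec θ)) := by
          intro r hr
          have hr0 : 0 < r := hr
          have hvec : Complex.orthonormalBasisOneI.repr (Complex.polarCoord.symm (r, θ)) =
              r • unitVec θ := by
            rw [Complex.polarCoord_symm_apply, unitVec, ← LinearIsometryEquiv.map_smul,
              Complex.real_smul]
          have hk : regKernel ε j (r • unitVec θ) = unitVec θ j * (r / (r ^ 2 + ε ^ 2)) / r := by
            rw [regKernel, norm_smul, norm_unitVec, mul_one, Real.norm_of_nonneg hr0.le,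
              PiLp.smul_apply, smul_eq_mul]
            field_simp
          rw [hvec, hF]
          simp only [hk, neg_sq, neg_smul, sub_neg_eq_add, Complex.real_smul]
          have hr1 : (r : ℂ) ≠ 0 := by exact_mod_cast hr0.ne'
          push_cast
          field_simp
          ring
        rw [setIntegral_congr_fun measurableSet_Ioi hpt, integral_const_mul]
        congr 1
        have hi := integrable_conjPoisson_slice hε hf θ x
        have hi' := hi.comp_neg
        rw [integral_add hi.integrableOn hi'.integrableOn,
          integral_comp_neg_Ioi (0 : ℝ) (fun r : ℝ => ((r / (r ^ 2 + ε ^ 2) : ℝ) : ℂ) *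
            f (x - r • unitVec θ)), neg_zero, add_comm, dirHilbert,
          intervalIntegral.integral_Iic_add_Ioi hi.integrableOn hi.integrableOn]

/-- The average over directions is handled by Jensen's inequality; the bound is uniform in `ε`. -/
theorem exists_lintegral_regRiesz_le {p : ℝ} (hp1 : 1 < p) :
    ∃ C : ℝ≥0∞, C ≠ ∞ ∧ ∀ ε : ℝ, 0 < ε → ∀ j f, IsTestFunction f →
      ∫⁻ x, ‖regRiesz ε j f x‖ₑ ^ p ≤ C * ∫⁻ x, ‖f x‖ₑ ^ p := by
  obtain ⟨C, hC, h⟩ := exists_lintegral_dirHilbert_le hp1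
  have hp0 : 0 < p := by linarith
  set m : ℝ≥0∞ := volume (Set.Ioo (-Real.pi) Real.pi) with hm
  have hm' : m ≠ ∞ := by rw [hm, Real.volume_Ioo]; exact ENNReal.ofReal_ne_top
  have hmp : m ^ (p - 1) ≠ ∞ := ENNReal.rpow_ne_top_of_nonneg (by linarith) hm'
  refine ⟨m ^ (p - 1) * (C * m), ENNReal.mul_ne_top hmp (ENNReal.mul_ne_top hC hm'),
    fun ε hε j f hf => ?_⟩
  have hmeas : Measurable fun z : EuclideanSpace ℝ (Fin 2) × ℝ => ‖dirHilbert ε f z.2 z.1‖ₑ ^ p :=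
    (measurable_dirHilbert ε hf.continuous).enorm.pow_const p
  have hmx : ∀ x, Measurable fun θ => ‖dirHilbert ε f θ x‖ₑ := fun x =>
    ((measurable_dirHilbert ε hf.continuous).comp (measurable_const.prodMk measurable_id)).enorm
  have hpt : ∀ x, ‖regRiesz ε j f x‖ₑ ^ p ≤
      m ^ (p - 1) * ∫⁻ θ in Set.Ioo (-Real.pi) Real.pi, ‖dirHilbert ε f θ x‖ₑ ^ p := by
    intro x
    have hJ := rpow_lintegral_le (volume.restrict (Set.Ioo (-Real.pi) Real.pi)) hp1
      (hmx x).aemeasurable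
    rw [Measure.restrict_apply_univ] at hJ
    refine le_trans (ENNReal.rpow_le_rpow ?_ hp0.le) hJ
    rw [regRiesz_eq hε j hf, enorm_mul]
    have h1 : ‖(1 / 2 : ℂ)‖ₑ ≤ 1 := by
      rw [← ofReal_norm]; norm_num
    refine (mul_le_of_le_one_left' h1).trans ((enorm_integral_le_lintegral_enorm _).trans ?_)
    refine lintegral_mono fun θ => ?_
    rw [enorm_mul]
    refine mul_le_of_le_one_left' ?_
    rw [← ofReal_norm, Complex.norm_real, ENNReal.ofReal_le_one, Real.norm_eq_abs]
    exact (abs_apply_le_norm _ _).trans_eq (norm_unitVec θ)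
  calc ∫⁻ x, ‖regRiesz ε j f x‖ₑ ^ p
      ≤ ∫⁻ x, m ^ (p - 1) * ∫⁻ θ in Set.Ioo (-Real.pi) Real.pi, ‖dirHilbert ε f θ x‖ₑ ^ p :=
        lintegral_mono hpt
    _ = m ^ (p - 1) *
          ∫⁻ θ in Set.Ioo (-Real.pi) Real.pi, ∫⁻ x, ‖dirHilbert ε f θ x‖ₑ ^ p := by
        rw [lintegral_const_mul' _ _ hmp, lintegral_lintegral_swap hmeas.aemeasurable]
    _ ≤ m ^ (p - 1) * ∫⁻ _ in Set.Ioo (-Real.pi) Real.pi, C * ∫⁻ x, ‖f x‖ₑ ^ p := by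
        gcongr with θ
        exact h ε hε f hf θ
    _ = _ := by
        rw [setLIntegral_const]; ring

/-! ### Principal values, chirps and pointwise convergence -/

theorem tendsto_integral_mul_symm_diff {ι : Type*} {l : Filter ι} [l.IsCountablyGenerated]
    {f : EuclideanSpace ℝ (Fin 2) → ℂ} (hf : IsTestFunction f)
    {k : ι → EuclideanSpace ℝ (Fin 2) → ℝ} {k₀ : EuclideanSpace ℝ (Fin 2) → ℝ}
    (hk : ∀ i, Measurable (k i)) (hk' : ∀ i y, |k i y| ≤ (‖y‖ ^ 2)⁻¹)
    (hlim : ∀ y, Tendsto (fun i => k i y) l (𝓝 (k₀ y))) (x : EuclideanSpace ℝ (Fin 2)) :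
    Tendsto (fun i => ∫ y, (k i y : ℂ) * (f (x - y) - f (x + y))) l
      (𝓝 (∫ y, (k₀ y : ℂ) * (f (x - y) - f (x + y)))) := by
  obtain ⟨M, hM⟩ := hf.exists_symm_diff_le x
  refine tendsto_integral_filter_of_dominated_convergence _
    (Eventually.of_forall fun i => (hf.integrable_mul_symm_diff (hk i) (hk' i) x).1)
    (Eventually.of_forall fun i => ae_of_all _ fun y => norm_mul_symm_diff_le (hk' i y) (hM y))
    (integrable_inv_norm_mul_rpow.const_mul M) (ae_of_all _ fun y => ?_)
  exact ((Complex.continuous_ofReal.tendsto _).comp (hlim y)).mul_const _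

theorem tendsto_regRiesz (j : Fin 2) {f : EuclideanSpace ℝ (Fin 2) → ℂ} (hf : IsTestFunction f)
    (x : EuclideanSpace ℝ (Fin 2)) :
    Tendsto (fun n : ℕ => regRiesz (1 / ((n : ℝ) + 1)) j f x) atTop (𝓝 (regRiesz 0 j f x)) := by
  refine (tendsto_integral_mul_symm_diff hf (fun n => measurable_regKernel _ j)
    (fun n => abs_regKernel_le _ j) (fun y => ?_) x).const_mul _
  rcases eq_or_ne y 0 with rfl | hy
  · simp [regKernel]
  have h := tendsto_one_div_add_atTop_nhds_zero_nat (𝕜 := ℝ)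
  have hc : ContinuousAt (fun ε : ℝ => regKernel ε j y) 0 := by
    unfold regKernel
    refine ContinuousAt.div (by fun_prop) (by fun_prop) ?_
    simpa using hy
  exact hc.tendsto.comp h

/-- The singular integral with the kernel `y_j / ‖y‖ ^ 3` is bounded on `L^p`. -/
theorem exists_lintegral_regRiesz_zero_le {p : ℝ} (hp1 : 1 < p) :
    ∃ C : ℝ≥0∞, C ≠ ∞ ∧ ∀ j f, IsTestFunction f →
      ∫⁻ x, ‖regRiesz 0 j f x‖ₑ ^ p ≤ C * ∫⁻ x, ‖f x‖ₑ ^ p := by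
  obtain ⟨C, hC, h⟩ := exists_lintegral_regRiesz_le hp1
  refine ⟨C, hC, fun j f hf => ?_⟩
  have hlim : ∀ x, ‖regRiesz 0 j f x‖ₑ ^ p =
      liminf (fun n : ℕ => ‖regRiesz (1 / ((n : ℝ) + 1)) j f x‖ₑ ^ p) atTop := fun x =>
    (((ENNReal.continuous_rpow_const.comp continuous_enorm).tendsto _).comp
      (tendsto_regRiesz j hf x)).liminf_eq.symm
  simp_rw [hlim]
  refine (lintegral_liminf_le fun n => ?_).trans ?_
  · exact ((measurable_integral_mul_symm_diff hf.continuous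
      (measurable_regKernel _ j)).const_mul _).enorm.pow_const p
  · refine (liminf_le_liminf (Eventually.of_forall fun n => h _ ?_ j f hf)).trans_eq
      (liminf_const _)
    positivity

theorem IsTestFunction.integrable {f : EuclideanSpace ℝ (Fin 2) → ℂ} (hf : IsTestFunction f) :
    Integrable f := by
  obtain ⟨C, hC⟩ := hf.decay
  refine ((integrable_one_add_norm (E := EuclideanSpace ℝ (Fin 2)) (r := 3) ?_).const_mul C).mono'
    hf.continuous.aestronglyMeasurable (ae_of_all _ hC)
  rw [finrank_euclideanSpace, Fintype.card_fin]; norm_num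

theorem IsTestFunction.add {f g : EuclideanSpace ℝ (Fin 2) → ℂ} (hf : IsTestFunction f)
    (hg : IsTestFunction g) : IsTestFunction (f + g) := by
  refine ⟨hf.continuous.add hg.continuous, ?_, fun x => ?_⟩
  · obtain ⟨C, hC⟩ := hf.decay
    obtain ⟨D, hD⟩ := hg.decay
    refine ⟨C + D, fun x => (norm_add_le _ _).trans ?_⟩
    linarith [hC x, hD x]
  · obtain ⟨C, hC⟩ := hf.symm_lipschitz x
    obtain ⟨D, hD⟩ := hg.symm_lipschitz x
    refine ⟨C + D, fun y => ?_⟩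
    have h : (f + g) (x - y) - (f + g) (x + y) =
        (f (x - y) - f (x + y)) + (g (x - y) - g (x + y)) := by
      simp only [Pi.add_apply]; ring
    rw [h]
    refine (norm_add_le _ _).trans ?_
    linarith [hC y, hD y]

theorem IsTestFunction.const_smul {f : EuclideanSpace ℝ (Fin 2) → ℂ} (hf : IsTestFunction f)
    (c : ℂ) : IsTestFunction (c • f) := by
  refine ⟨hf.continuous.const_smul c, ?_, fun x => ?_⟩
  · obtain ⟨C, hC⟩ := hf.decay
    refine ⟨‖c‖ * C, fun x => ?_⟩
    rw [Pi.smul_apply, norm_smul, mul_assoc]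
    gcongr
    exact hC x
  · obtain ⟨C, hC⟩ := hf.symm_lipschitz x
    refine ⟨‖c‖ * C, fun y => ?_⟩
    rw [Pi.smul_apply, Pi.smul_apply, ← smul_sub, norm_smul, mul_assoc]
    gcongr
    exact hC y

theorem regRiesz_add (ε : ℝ) (j : Fin 2) {f g : EuclideanSpace ℝ (Fin 2) → ℂ}
    (hf : IsTestFunction f) (hg : IsTestFunction g) :
    regRiesz ε j (f + g) = regRiesz ε j f + regRiesz ε j g := by
  ext x
  rw [Pi.add_apply, regRiesz, regRiesz, regRiesz, ← mul_add, ← integral_add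
    (hf.integrable_mul_symm_diff (measurable_regKernel ε j) (abs_regKernel_le ε j) x)
    (hg.integrable_mul_symm_diff (measurable_regKernel ε j) (abs_regKernel_le ε j) x)]
  congr 2; ext y
  simp only [Pi.add_apply]; ring

theorem regRiesz_smul (ε : ℝ) (j : Fin 2) (c : ℂ) (f : EuclideanSpace ℝ (Fin 2) → ℂ) :
    regRiesz ε j (c • f) = c • regRiesz ε j f := by
  ext x
  rw [Pi.smul_apply, regRiesz, regRiesz, smul_eq_mul, mul_left_comm,
    ← integral_const_mul c]
  congr 2; ext y
  simp only [Pi.smul_apply, smul_eq_mul]; ring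

theorem regKernel_neg (ε : ℝ) (j : Fin 2) (y : EuclideanSpace ℝ (Fin 2)) :
    regKernel ε j (-y) = -regKernel ε j y := by
  rw [regKernel, regKernel, norm_neg, PiLp.neg_apply, neg_div]

/-- The principal value exists and is the symmetrized, absolutely convergent integral. -/
theorem isPV_regRiesz (j : Fin 2) {f : EuclideanSpace ℝ (Fin 2) → ℂ} (hf : IsTestFunction f)
    (x : EuclideanSpace ℝ (Fin 2)) :
    IsPV x (fun y => ((x j - y j : ℝ) : ℂ) * f y / ((‖x - y‖ ^ 3 : ℝ) : ℂ))
      (regRiesz 0 j f x) := by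
  have hS : ∀ ε : ℝ, MeasurableSet {y : EuclideanSpace ℝ (Fin 2) | ε ≤ ‖y‖} := fun ε =>
    measurableSet_le measurable_const measurable_norm
  set κ : ℝ → EuclideanSpace ℝ (Fin 2) → ℝ := fun ε =>
    {y : EuclideanSpace ℝ (Fin 2) | ε ≤ ‖y‖}.indicator (regKernel 0 j) with hκ
  have hκm : ∀ ε, Measurable (κ ε) := fun ε => (measurable_regKernel 0 j).indicator (hS ε)
  have hκle : ∀ ε y, |κ ε y| ≤ (‖y‖ ^ 2)⁻¹ := fun ε y => by
    by_cases hy : ε ≤ ‖y‖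
    · simp only [hκ, Set.indicator, Set.mem_ofPred_eq, hy, if_true]; exact abs_regKernel_le 0 j y
    · simp only [hκ, Set.indicator, Set.mem_ofPred_eq, hy, if_false, abs_zero]; positivity
  have hκbd : ∀ ε, 0 < ε → ∀ y, ‖(κ ε y : ℂ)‖ ≤ (ε ^ 2)⁻¹ := fun ε hε y => by
    rw [Complex.norm_real]
    by_cases hy : ε ≤ ‖y‖
    · refine (hκle ε y).trans ?_
      gcongr
    · simp only [hκ, Set.indicator, Set.mem_ofPred_eq, hy, if_false, norm_zero]; positivity
  have hκneg : ∀ ε y, κ ε (-y) = -κ ε y := fun ε y => by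
    by_cases hy : ε ≤ ‖y‖ <;> simp [hκ, hy, regKernel_neg]
  have hfi := hf.integrable
  have hint : ∀ ε, 0 < ε → Integrable fun z => (κ ε z : ℂ) * f (x - z) := fun ε hε =>
    (hfi.comp_sub_left x).bdd_mul (Complex.measurable_ofReal.comp (hκm ε)).aestronglyMeasurable
      (ae_of_all _ (hκbd ε hε))
  have hint' : ∀ ε, 0 < ε → Integrable fun z => (κ ε z : ℂ) * f (x + z) := fun ε hε =>
    (hfi.comp_add_left x).bdd_mul (Complex.measurable_ofReal.comp (hκm ε)).aestronglyMeasurable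
      (ae_of_all _ (hκbd ε hε))
  have hset : ∀ ε, MeasurableSet {y | ε ≤ ‖x - y‖} := fun ε =>
    measurableSet_le measurable_const (by fun_prop)
  have hind : ∀ ε, {y | ε ≤ ‖x - y‖}.indicator
      (fun y => ((x j - y j : ℝ) : ℂ) * f y / ((‖x - y‖ ^ 3 : ℝ) : ℂ)) =
      fun y => (κ ε (x - y) : ℂ) * f (x - (x - y)) := fun ε => by
    ext y
    by_cases hy : ε ≤ ‖x - y‖
    · simp only [hκ, Set.indicator, Set.mem_ofPred_eq, hy, if_true, regKernel, sub_sub_cancel,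
        PiLp.sub_apply]
      push_cast
      ring
    · simp [hκ, Set.indicator, hy]
  refine ⟨fun ε hε => ?_, ?_⟩
  · rw [← integrable_indicator_iff (hset ε), hind]
    exact (hint ε hε).comp_sub_left x
  -- the truncated kernel is odd, so the truncated integrals can be symmetrized
  · have heq : ∀ ε, 0 < ε → ∫ y in {y | ε ≤ ‖x - y‖},
        ((x j - y j : ℝ) : ℂ) * f y / ((‖x - y‖ ^ 3 : ℝ) : ℂ) =
        1 / 2 * ∫ z, (κ ε z : ℂ) * (f (x - z) - f (x + z)) := fun ε hε => by
      have h1 : ∫ z, (κ ε z : ℂ) * f (x - z) = -∫ z, (κ ε z : ℂ) * f (x + z) := by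
        rw [← integral_neg_eq_self, ← integral_neg]
        congr 1; ext z
        rw [hκneg, sub_neg_eq_add]; push_cast; ring
      simp_rw [mul_sub]
      rw [← integral_indicator (hset ε), hind,
        integral_sub_left_eq_self (fun z => (κ ε z : ℂ) * f (x - z)) volume x,
        integral_sub (hint ε hε) (hint' ε hε), h1]
      ring
    refine Tendsto.congr' (f₁ := fun ε => 1 / 2 * ∫ z, (κ ε z : ℂ) * (f (x - z) - f (x + z))) ?_ ?_
    · filter_upwards [self_mem_nhdsWithin] with ε hε
      exact (heq ε hε).symm
    · refine (tendsto_integral_mul_symm_diff hf hκm hκle (fun y => ?_) x).const_mul _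
      rcases eq_or_ne y 0 with rfl | hy
      · have : ∀ ε, κ ε 0 = regKernel 0 j 0 := fun ε => by
          simp [hκ, Set.indicator, regKernel]
        simp_rw [this]
        exact tendsto_const_nhds
      · refine tendsto_const_nhds.congr' ?_
        have : Set.Iio ‖y‖ ∈ 𝓝[>] (0 : ℝ) :=
          mem_nhdsWithin_of_mem_nhds (Iio_mem_nhds (norm_pos_iff.2 hy))
        filter_upwards [this] with ε hε
        have h' : ε ≤ ‖y‖ := le_of_lt hε
        simp [hκ, h']

theorem IsPV.pvIntegral_eq {n : ℕ} {x : EuclideanSpace ℝ (Fin n)}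
    {F : EuclideanSpace ℝ (Fin n) → ℂ} {L : ℂ} (h : IsPV x F L) : pvIntegral x F = L :=
  h.2.limUnder_eq

/-- The chirp `exp (i ∑ₖ αₖ xₖ²)`. -/
noncomputable def quadChirp (α : Fin 2 → ℝ) (x : EuclideanSpace ℝ (Fin 2)) : ℂ :=
  Complex.exp (Complex.I * ((∑ k, α k * x k ^ 2 : ℝ) : ℂ))

theorem norm_quadChirp (α : Fin 2 → ℝ) (x : EuclideanSpace ℝ (Fin 2)) : ‖quadChirp α x‖ = 1 :=
  Complex.norm_exp_I_mul_ofReal _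

theorem quadChirp_zero (x : EuclideanSpace ℝ (Fin 2)) : quadChirp 0 x = 1 := by
  simp [quadChirp]

theorem continuous_quadChirp_uncurry :
    Continuous fun z : (Fin 2 → ℝ) × EuclideanSpace ℝ (Fin 2) => quadChirp z.1 z.2 := by
  unfold quadChirp
  fun_prop

theorem continuous_quadChirp (α : Fin 2 → ℝ) : Continuous (quadChirp α) :=
  continuous_quadChirp_uncurry.comp (continuous_const.prodMk continuous_id)

theorem tendsto_quadChirp (x : EuclideanSpace ℝ (Fin 2)) :
    Tendsto (fun α => quadChirp α x) (𝓝 0) (𝓝 1) := by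
  have h := (continuous_quadChirp_uncurry.comp (continuous_id.prodMk continuous_const :
    Continuous fun α : Fin 2 → ℝ => (α, x))).tendsto 0
  simpa [quadChirp_zero] using! h

/-- The symmetric difference of the phase is `-4 ∑ₖ αₖ xₖ yₖ`, which is linear in `y`. -/
theorem norm_quadChirp_sub_le {B : ℝ} {α : Fin 2 → ℝ} (hα : ∀ k, |α k| ≤ B)
    (x y : EuclideanSpace ℝ (Fin 2)) :
    ‖quadChirp α (x - y) - quadChirp α (x + y)‖ ≤ 8 * B * ‖x‖ * ‖y‖ := by
  have hB : 0 ≤ B := (abs_nonneg _).trans (hα 0)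
  set a : ℝ := ∑ k, α k * (x - y) k ^ 2
  set b : ℝ := ∑ k, α k * (x + y) k ^ 2
  have h1 : quadChirp α (x - y) - quadChirp α (x + y) =
      quadChirp α (x + y) * (Complex.exp (Complex.I * ((a - b : ℝ) : ℂ)) - 1) := by
    have ha : quadChirp α (x - y) = Complex.exp (Complex.I * (a : ℂ)) := rfl
    have hb : quadChirp α (x + y) = Complex.exp (Complex.I * (b : ℂ)) := rfl
    rw [ha, hb, mul_sub, ← Complex.exp_add, ← mul_add, mul_one, Complex.ofReal_sub,
      add_sub_cancel]
  rw [h1, norm_mul, norm_quadChirp, one_mul]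
  refine (Real.norm_exp_I_mul_ofReal_sub_one_le (x := a - b)).trans ?_
  have h2 : a - b = ∑ k, α k * (-4 * (x k * y k)) := by
    rw [← Finset.sum_sub_distrib]
    refine Finset.sum_congr rfl fun k _ => ?_
    simp only [PiLp.sub_apply, PiLp.add_apply]; ring
  rw [h2]
  refine (norm_sum_le _ _).trans ?_
  have h3 : ∀ k, ‖α k * (-4 * (x k * y k))‖ ≤ 4 * B * ‖x‖ * ‖y‖ := fun k => by
    rw [norm_mul, norm_mul, norm_mul]
    have h4 : ‖(-4 : ℝ)‖ = 4 := by norm_num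
    rw [h4]
    calc ‖α k‖ * (4 * (‖x k‖ * ‖y k‖)) ≤ B * (4 * (‖x‖ * ‖y‖)) := by
          gcongr
          · exact hα k
          · exact PiLp.norm_apply_le x k
          · exact PiLp.norm_apply_le y k
      _ = _ := by ring
  refine (Finset.sum_le_sum fun k _ => h3 k).trans_eq ?_
  simp; ring

theorem SchwartzMap.exists_decay (f : 𝓢(EuclideanSpace ℝ (Fin 2), ℂ)) :
    ∃ C : ℝ, ∀ x, ‖f x‖ ≤ C * (1 + ‖x‖) ^ (-3 : ℝ) := by
  refine ⟨2 ^ 3 * (Finset.Iic (3, 0)).sup (fun m => SchwartzMap.seminorm ℝ m.1 m.2) f,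
    fun x => ?_⟩
  have h := SchwartzMap.one_add_le_sup_seminorm_apply (𝕜 := ℝ) (m := (3, 0)) (k := 3) (n := 0)
    le_rfl le_rfl f x
  rw [norm_iteratedFDeriv_zero] at h
  have hx : 0 < 1 + ‖x‖ := by positivity
  rw [Real.rpow_neg hx.le, ← div_eq_mul_inv, le_div_iff₀ (by positivity), mul_comm]
  exact_mod_cast h

theorem SchwartzMap.exists_norm_sub_le (f : 𝓢(EuclideanSpace ℝ (Fin 2), ℂ)) :
    ∃ L : ℝ, ∀ x y, ‖f x - f y‖ ≤ L * ‖x - y‖ := by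
  obtain ⟨L, -, hL⟩ := f.decay 0 1
  refine ⟨L, fun x y => ?_⟩
  refine Convex.norm_image_sub_le_of_norm_fderiv_le (𝕜 := ℝ) (s := Set.univ)
    (fun z _ => f.differentiableAt) (fun z _ => ?_) convex_univ (Set.mem_univ _) (Set.mem_univ _)
  have := hL z
  rwa [pow_zero, one_mul, norm_iteratedFDeriv_one] at this

/-- The symmetric differences of a Schwartz function times a chirp are controlled uniformly for
bounded chirp parameters. -/
theorem SchwartzMap.exists_symm_lipschitz_mul_quadChirp (f : 𝓢(EuclideanSpace ℝ (Fin 2), ℂ))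
    (B : ℝ) (x : EuclideanSpace ℝ (Fin 2)) :
    ∃ L : ℝ, ∀ α : Fin 2 → ℝ, (∀ k, |α k| ≤ B) → ∀ y,
      ‖f (x - y) * quadChirp α (x - y) - f (x + y) * quadChirp α (x + y)‖ ≤ L * ‖y‖ := by
  obtain ⟨L, hL⟩ := f.exists_norm_sub_le
  obtain ⟨C, -, hC⟩ := f.decay 0 0
  refine ⟨L * 2 + C * (8 * B * ‖x‖), fun α hα y => ?_⟩
  have h1 : f (x - y) * quadChirp α (x - y) - f (x + y) * quadChirp α (x + y) =
      (f (x - y) - f (x + y)) * quadChirp α (x - y) +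
        f (x + y) * (quadChirp α (x - y) - quadChirp α (x + y)) := by ring
  have h2 : ‖f (x - y) - f (x + y)‖ ≤ L * (2 * ‖y‖) := by
    refine (hL _ _).trans_eq ?_
    have : x - y - (x + y) = -(2 : ℝ) • y := by rw [neg_smul, two_smul]; abel
    rw [this, norm_smul]; norm_num
  have h3 : ‖f (x + y)‖ ≤ C := by simpa using hC (x + y)
  have hC0 : 0 ≤ C := (norm_nonneg _).trans h3
  rw [h1]
  refine (norm_add_le _ _).trans ?_
  rw [norm_mul, norm_mul, norm_quadChirp, mul_one]
  have h4 := mul_le_mul h3 (norm_quadChirp_sub_le hα x y) (norm_nonneg _) hC0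
  linarith

theorem SchwartzMap.isTestFunction_mul_quadChirp (f : 𝓢(EuclideanSpace ℝ (Fin 2), ℂ))
    (α : Fin 2 → ℝ) : IsTestFunction fun x => f x * quadChirp α x := by
  refine ⟨f.continuous.mul (continuous_quadChirp α), ?_, fun x => ?_⟩
  · obtain ⟨C, hC⟩ := f.exists_decay
    exact ⟨C, fun x => by rw [norm_mul, norm_quadChirp, mul_one]; exact hC x⟩
  · obtain ⟨L, hL⟩ := f.exists_symm_lipschitz_mul_quadChirp (∑ k, |α k|) x
    exact ⟨L, hL α fun k => Finset.single_le_sum (f := fun k => |α k|)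
      (fun i _ => abs_nonneg _) (Finset.mem_univ k)⟩

theorem SchwartzMap.isTestFunction (f : 𝓢(EuclideanSpace ℝ (Fin 2), ℂ)) : IsTestFunction f := by
  simpa [quadChirp_zero] using f.isTestFunction_mul_quadChirp 0

/-- Multiplication by the chirp with parameters `α`, the Riesz transform, and multiplication by the
chirp with parameters `β`. -/
noncomputable def chirpRiesz (j : Fin 2) (α β : Fin 2 → ℝ) (f : EuclideanSpace ℝ (Fin 2) → ℂ)
    (x : EuclideanSpace ℝ (Fin 2)) : ℂ :=
  (rieszConst 2 : ℂ) * quadChirp β x * regRiesz 0 j (fun y => f y * quadChirp α y) x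

/-- The dominated convergence theorem is applicable because the symmetric differences are
controlled uniformly in the parameters. -/
theorem tendsto_chirpRiesz (j : Fin 2) (f : 𝓢(EuclideanSpace ℝ (Fin 2), ℂ))
    (x : EuclideanSpace ℝ (Fin 2)) :
    Tendsto (fun z : (Fin 2 → ℝ) × (Fin 2 → ℝ) => chirpRiesz j z.1 z.2 f x) (𝓝 0)
      (𝓝 (chirpRiesz j 0 0 f x)) := by
  have hβ : Tendsto (fun z : (Fin 2 → ℝ) × (Fin 2 → ℝ) => quadChirp z.2 x) (𝓝 0)
      (𝓝 (quadChirp 0 x)) := by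
    rw [quadChirp_zero]
    exact (tendsto_quadChirp x).comp (continuous_snd.tendsto' 0 0 rfl)
  have hα : ∀ y, Tendsto (fun z : (Fin 2 → ℝ) × (Fin 2 → ℝ) => quadChirp z.1 y) (𝓝 0)
      (𝓝 (quadChirp 0 y)) := fun y => by
    rw [quadChirp_zero]
    exact (tendsto_quadChirp y).comp (continuous_fst.tendsto' 0 0 rfl)
  refine (hβ.const_mul _).mul ?_
  obtain ⟨C, hC⟩ := f.exists_decay
  obtain ⟨L, hL⟩ := f.exists_symm_lipschitz_mul_quadChirp 1 x
  have hsmall : ∀ᶠ z : (Fin 2 → ℝ) × (Fin 2 → ℝ) in 𝓝 0, ∀ k, |z.1 k| ≤ 1 := by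
    filter_upwards [Metric.ball_mem_nhds 0 one_pos] with z hz k
    rw [mem_ball_zero_iff] at hz
    exact (norm_le_pi_norm z.1 k).trans ((norm_fst_le z).trans hz.le)
  refine Tendsto.const_mul _ (tendsto_integral_filter_of_dominated_convergence
    (fun y => (8 * L + 2 * C * (1 + ‖x‖) ^ (3 : ℝ)) *
      ((‖y‖ ^ 2)⁻¹ * (‖y‖ * (1 + ‖y‖) ^ (-3 : ℝ))))
    (Eventually.of_forall fun z => ((f.isTestFunction_mul_quadChirp z.1).integrable_mul_symm_diff
      (measurable_regKernel 0 j) (abs_regKernel_le 0 j) x).1) ?_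
    (integrable_inv_norm_mul_rpow.const_mul _) (ae_of_all _ fun y => ?_))
  · filter_upwards [hsmall] with z hz
    refine ae_of_all _ fun y => norm_mul_symm_diff_le (f := fun y => f y * quadChirp z.1 y)
      (abs_regKernel_le 0 j y) ?_
    refine norm_symm_diff_le (f := fun y => f y * quadChirp z.1 y) (fun w => ?_) (hL z.1 hz) y
    rw [norm_mul, norm_quadChirp, mul_one]; exact hC w
  · exact (((hα _).const_mul _).sub ((hα _).const_mul _)).const_mul _

/-! ### Bounded extensions and convergence in `L^p` -/

theorem measurable_regRiesz (ε : ℝ) (j : Fin 2) {f : EuclideanSpace ℝ (Fin 2) → ℂ}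
    (hf : Continuous f) : Measurable (regRiesz ε j f) :=
  (measurable_integral_mul_symm_diff hf (measurable_regKernel ε j)).const_mul _

theorem exists_eLpNorm_regRiesz_le {p : ℝ≥0∞} (hp1 : 1 < p) (hp : p < ∞) :
    ∃ C : ℝ≥0∞, C ≠ ∞ ∧ ∀ j f, IsTestFunction f →
      eLpNorm (fun x => (rieszConst 2 : ℂ) * regRiesz 0 j f x) p volume ≤
        C * eLpNorm f p volume := by
  have hp0 : p ≠ 0 := (one_pos.trans hp1).ne'
  have hr1 : 1 < p.toReal := by
    rw [← ENNReal.toReal_one]; exact (ENNReal.toReal_lt_toReal (by simp) hp.ne).2 hp1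
  have hr0 : 0 < p.toReal := by linarith
  obtain ⟨C, hC, h⟩ := exists_lintegral_regRiesz_zero_le hr1
  refine ⟨‖(rieszConst 2 : ℂ)‖ₑ * C ^ (1 / p.toReal), ENNReal.mul_ne_top enorm_ne_top
    (ENNReal.rpow_ne_top_of_nonneg (by positivity) hC), fun j f hf => ?_⟩
  have h1 : eLpNorm (fun x => (rieszConst 2 : ℂ) * regRiesz 0 j f x) p volume =
      ‖(rieszConst 2 : ℂ)‖ₑ * eLpNorm (regRiesz 0 j f) p volume :=
    eLpNorm_const_smul (rieszConst 2 : ℂ) (regRiesz 0 j f) p volume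
  rw [h1, mul_assoc]
  gcongr
  rw [eLpNorm_eq_lintegral_rpow_enorm_toReal hp0 hp.ne,
    eLpNorm_eq_lintegral_rpow_enorm_toReal hp0 hp.ne,
    ← ENNReal.mul_rpow_of_nonneg _ _ (by positivity)]
  gcongr
  exact h j f hf

theorem aestronglyMeasurable_chirpRiesz (j : Fin 2) (α β : Fin 2 → ℝ)
    {f : EuclideanSpace ℝ (Fin 2) → ℂ} (hf : Continuous f) :
    AEStronglyMeasurable (chirpRiesz j α β f) := by
  have h1 := measurable_regRiesz 0 j (hf.mul (continuous_quadChirp α))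
  have h2 := (continuous_quadChirp β).measurable
  unfold chirpRiesz
  exact ((h2.const_mul _).mul h1).aestronglyMeasurable

theorem eLpNorm_mul_quadChirp (p : ℝ≥0∞) (α : Fin 2 → ℝ) (f : EuclideanSpace ℝ (Fin 2) → ℂ) :
    eLpNorm (fun x => f x * quadChirp α x) p volume = eLpNorm f p volume :=
  eLpNorm_congr_norm_ae (ae_of_all _ fun x => by rw [norm_mul, norm_quadChirp, mul_one])

/-- The bound does not depend on the chirp parameters, as multiplication by a chirp is an
isometry. -/
theorem exists_eLpNorm_chirpRiesz_le {p : ℝ≥0∞} (hp1 : 1 < p) (hp : p < ∞) :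
    ∃ C : ℝ≥0∞, C ≠ ∞ ∧ ∀ j α β (g : 𝓢(EuclideanSpace ℝ (Fin 2), ℂ)),
      eLpNorm (chirpRiesz j α β g) p volume ≤ C * eLpNorm g p volume := by
  obtain ⟨C, hC, h⟩ := exists_eLpNorm_regRiesz_le hp1 hp
  refine ⟨C, hC, fun j α β g => ?_⟩
  have h1 := h j _ (g.isTestFunction_mul_quadChirp α)
  rw [eLpNorm_mul_quadChirp] at h1
  refine le_trans (le_of_eq ?_) h1
  refine eLpNorm_congr_norm_ae (ae_of_all _ fun x => ?_)
  rw [chirpRiesz, norm_mul, norm_mul, norm_mul, norm_quadChirp, mul_one]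

theorem chirpRiesz_add (j : Fin 2) (α β : Fin 2 → ℝ) (f g : 𝓢(EuclideanSpace ℝ (Fin 2), ℂ)) :
    chirpRiesz j α β (f + g : 𝓢(EuclideanSpace ℝ (Fin 2), ℂ)) =
      chirpRiesz j α β f + chirpRiesz j α β g := by
  ext x
  have h : (fun y => (f + g : 𝓢(EuclideanSpace ℝ (Fin 2), ℂ)) y * quadChirp α y) =
      (fun y => f y * quadChirp α y) + fun y => g y * quadChirp α y := by
    ext y; simp only [add_apply, Pi.add_apply, add_mul]
  rw [Pi.add_apply, chirpRiesz, chirpRiesz, chirpRiesz, h,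
    regRiesz_add 0 j (f.isTestFunction_mul_quadChirp α) (g.isTestFunction_mul_quadChirp α),
    Pi.add_apply, mul_add]

theorem chirpRiesz_smul (j : Fin 2) (α β : Fin 2 → ℝ) (c : ℂ)
    (f : 𝓢(EuclideanSpace ℝ (Fin 2), ℂ)) :
    chirpRiesz j α β (c • f : 𝓢(EuclideanSpace ℝ (Fin 2), ℂ)) = c • chirpRiesz j α β f := by
  ext x
  have h : (fun y => (c • f : 𝓢(EuclideanSpace ℝ (Fin 2), ℂ)) y * quadChirp α y) =
      c • fun y => f y * quadChirp α y := by
    ext y; simp only [smul_apply, Pi.smul_apply, smul_eq_mul, mul_assoc]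
  rw [Pi.smul_apply, chirpRiesz, chirpRiesz, h, regRiesz_smul, Pi.smul_apply, smul_eq_mul,
    smul_eq_mul]
  ring

theorem SchwartzMap.denseRange_toLp {p : ℝ≥0∞} [Fact (1 ≤ p)] (hp : p < ∞) :
    DenseRange fun g : 𝓢(EuclideanSpace ℝ (Fin 2), ℂ) => g.toLp p volume :=
  SchwartzMap.denseRange_toLpCLM hp.ne

/-- The extension of `chirpRiesz` to `L^p`, with a bound uniform in the parameters. -/
theorem exists_chirpRiesz_extension {p : ℝ≥0∞} [Fact (1 ≤ p)] (hp1 : 1 < p) (hp : p < ∞) :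
    ∃ (C : ℝ) (S : Fin 2 → (Fin 2 → ℝ) → (Fin 2 → ℝ) →
        Lp ℂ p (volume : Measure (EuclideanSpace ℝ (Fin 2))) →L[ℂ]
          Lp ℂ p (volume : Measure (EuclideanSpace ℝ (Fin 2)))),
      (∀ j α β f, ‖S j α β f‖ ≤ C * ‖f‖) ∧
      ∀ j α β (g : 𝓢(EuclideanSpace ℝ (Fin 2), ℂ)),
        S j α β (g.toLp p volume) =ᵐ[volume] chirpRiesz j α β g := by
  obtain ⟨C, hC, h⟩ := exists_eLpNorm_chirpRiesz_le hp1 hp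
  have hmem : ∀ j α β (g : 𝓢(EuclideanSpace ℝ (Fin 2), ℂ)), MemLp (chirpRiesz j α β g) p volume :=
    fun j α β g => ⟨aestronglyMeasurable_chirpRiesz j α β g.continuous,
      (h j α β g).trans_lt (ENNReal.mul_lt_top hC.lt_top (g.memLp p volume).2)⟩
  let T : Fin 2 → (Fin 2 → ℝ) → (Fin 2 → ℝ) → 𝓢(EuclideanSpace ℝ (Fin 2), ℂ) →ₗ[ℂ]
      Lp ℂ p (volume : Measure (EuclideanSpace ℝ (Fin 2))) := fun j α β =>
    { toFun := fun g => (hmem j α β g).toLp _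
      map_add' := fun f g => by
        rw [← MemLp.toLp_add]
        exact MemLp.toLp_congr _ _ (by rw [chirpRiesz_add])
      map_smul' := fun c g => by
        rw [RingHom.id_apply, ← MemLp.toLp_const_smul]
        exact MemLp.toLp_congr _ _ (by rw [chirpRiesz_smul]) }
  let e : 𝓢(EuclideanSpace ℝ (Fin 2), ℂ) →ₗ[ℂ]
      Lp ℂ p (volume : Measure (EuclideanSpace ℝ (Fin 2))) :=
    (SchwartzMap.toLpCLM ℂ ℂ p volume).toLinearMap
  have he : DenseRange e := SchwartzMap.denseRange_toLp hp
  have hbd : ∀ j α β g, ‖T j α β g‖ ≤ C.toReal * ‖e g‖ := fun j α β g => by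
    have h1 : ‖T j α β g‖ = (eLpNorm (chirpRiesz j α β g) p volume).toReal :=
      Lp.norm_toLp _ (hmem j α β g)
    have h2 : ‖e g‖ = (eLpNorm g p volume).toReal := SchwartzMap.norm_toLp
    rw [h1, h2, ← ENNReal.toReal_mul]
    exact ENNReal.toReal_mono (ENNReal.mul_ne_top hC (g.memLp p volume).2.ne) (h j α β g)
  refine ⟨C.toReal, fun j α β => (T j α β).extendOfNorm e, fun j α β f => ?_, fun j α β g => ?_⟩
  · exact LinearMap.norm_extendOfNorm_apply_le he _ (hbd j α β) f
  · have h1 : (T j α β).extendOfNorm e (g.toLp p volume) = T j α β g :=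
      LinearMap.extendOfNorm_eq he ⟨_, hbd j α β⟩ g
    rw [h1]
    exact (hmem j α β g).coeFn_toLp

theorem tendsto_eLpNorm_quadChirp_sub_one_mul {p : ℝ≥0∞} (hp1 : 1 < p) (hp : p < ∞)
    {h : EuclideanSpace ℝ (Fin 2) → ℂ} (hh : MemLp h p volume) :
    Tendsto (fun α => eLpNorm (fun x => (quadChirp α x - 1) * h x) p volume) (𝓝 0) (𝓝 0) := by
  have hp0 : p ≠ 0 := (one_pos.trans hp1).ne'
  have hr0 : 0 < p.toReal := ENNReal.toReal_pos hp0 hp.ne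
  have hfin : ∫⁻ x, (2 * ‖h x‖ₑ) ^ p.toReal ≠ ∞ := by
    simp_rw [ENNReal.mul_rpow_of_nonneg _ _ hr0.le]
    have h2 : (2 : ℝ≥0∞) ^ p.toReal ≠ ∞ := ENNReal.rpow_ne_top_of_nonneg hr0.le (by simp)
    rw [lintegral_const_mul' _ _ h2]
    exact ENNReal.mul_ne_top h2 (lintegral_rpow_enorm_lt_top_of_eLpNorm_lt_top hp0 hp.ne hh.2).ne
  have hlim : Tendsto (fun α => ∫⁻ x, ‖(quadChirp α x - 1) * h x‖ₑ ^ p.toReal) (𝓝 0)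
      (𝓝 (∫⁻ _ : EuclideanSpace ℝ (Fin 2), 0)) := by
    refine tendsto_lintegral_filter_of_dominated_convergence' _
      (Eventually.of_forall fun α => ?_) (Eventually.of_forall fun α => ae_of_all _ fun x => ?_)
      hfin (ae_of_all _ fun x => ?_)
    · exact ((((continuous_quadChirp α).aestronglyMeasurable.sub aestronglyMeasurable_const).mul
        hh.1).enorm).pow_const _
    · refine ENNReal.rpow_le_rpow ?_ hr0.le
      rw [enorm_mul]
      gcongr
      rw [← ofReal_norm]
      refine ENNReal.ofReal_le_of_le_toReal ?_
      refine (norm_sub_le _ _).trans ?_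
      rw [norm_quadChirp, norm_one]; norm_num
    · have h1 : Tendsto (fun α => ‖(quadChirp α x - 1) * h x‖ₑ) (𝓝 0) (𝓝 0) := by
        have := (((tendsto_quadChirp x).sub_const 1).mul_const (h x)).enorm
        simpa using this
      have h2 := (ENNReal.continuous_rpow_const (y := p.toReal)).tendsto 0
      rw [ENNReal.zero_rpow_of_pos hr0] at h2
      exact h2.comp h1
  simp_rw [eLpNorm_eq_lintegral_rpow_enorm_toReal hp0 hp.ne]
  have h2 := (ENNReal.continuous_rpow_const (y := 1 / p.toReal)).tendsto 0
  rw [ENNReal.zero_rpow_of_pos (by positivity)] at h2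
  rw [lintegral_zero] at hlim
  exact h2.comp hlim

/-- The difference is `(chirp of β) · R ((chirp of α - 1) g) + (chirp of β - 1) · R g`. -/
theorem tendsto_eLpNorm_chirpRiesz_sub {p : ℝ≥0∞} (hp1 : 1 < p) (hp : p < ∞) (j : Fin 2)
    (g : 𝓢(EuclideanSpace ℝ (Fin 2), ℂ)) :
    Tendsto (fun z : (Fin 2 → ℝ) × (Fin 2 → ℝ) =>
      eLpNorm (chirpRiesz j z.1 z.2 g - chirpRiesz j 0 0 g) p volume) (𝓝 0) (𝓝 0) := by
  obtain ⟨C, hC, h⟩ := exists_eLpNorm_regRiesz_le hp1 hp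
  have hg := g.isTestFunction
  set c : ℂ := (rieszConst 2 : ℂ) with hc
  set R : EuclideanSpace ℝ (Fin 2) → ℂ := fun x => c * regRiesz 0 j g x with hR
  have hRm : MemLp R p volume :=
    ⟨((measurable_regRiesz 0 j hg.continuous).const_mul c).aestronglyMeasurable,
      (h j g hg).trans_lt (ENNReal.mul_lt_top hC.lt_top (g.memLp p volume).2)⟩
  have hD : ∀ α, IsTestFunction fun x => (quadChirp α x - 1) * g x := fun α => by
    have h1 := (g.isTestFunction_mul_quadChirp α).add (hg.const_smul (-1))
    have h2 : (fun x => g x * quadChirp α x) + (-1 : ℂ) • (g : EuclideanSpace ℝ (Fin 2) → ℂ) =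
        fun x => (quadChirp α x - 1) * g x := by
      ext x; simp only [Pi.add_apply, Pi.smul_apply, smul_eq_mul]; ring
    rwa [h2] at h1
  have hsplit : ∀ z : (Fin 2 → ℝ) × (Fin 2 → ℝ), chirpRiesz j z.1 z.2 g - chirpRiesz j 0 0 g =
      (fun x => (c * regRiesz 0 j (fun y => (quadChirp z.1 y - 1) * g y) x) * quadChirp z.2 x) +
        fun x => (quadChirp z.2 x - 1) * R x := fun z => by
    have h1 : (fun y => g y * quadChirp z.1 y) =
        (fun y => (quadChirp z.1 y - 1) * g y) + (g : EuclideanSpace ℝ (Fin 2) → ℂ) := by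
      ext y; simp only [Pi.add_apply]; ring
    ext x
    simp only [Pi.sub_apply, Pi.add_apply, chirpRiesz, h1, regRiesz_add 0 j (hD z.1) hg,
      quadChirp_zero, mul_one, hR, ← hc]
    ring
  have hle : ∀ z : (Fin 2 → ℝ) × (Fin 2 → ℝ),
      eLpNorm (chirpRiesz j z.1 z.2 g - chirpRiesz j 0 0 g) p volume ≤
        C * eLpNorm (fun x => (quadChirp z.1 x - 1) * g x) p volume +
          eLpNorm (fun x => (quadChirp z.2 x - 1) * R x) p volume := fun z => by
    rw [hsplit]
    refine (eLpNorm_add_le ?_ ?_ hp1.le).trans ?_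
    · exact (((measurable_regRiesz 0 j (hD z.1).continuous).const_mul c).mul
        (continuous_quadChirp z.2).measurable).aestronglyMeasurable
    · exact ((continuous_quadChirp z.2).aestronglyMeasurable.sub aestronglyMeasurable_const).mul
        hRm.1
    · gcongr
      rw [eLpNorm_mul_quadChirp]
      exact h j _ (hD z.1)
  have h1 : Tendsto (fun z : (Fin 2 → ℝ) × (Fin 2 → ℝ) =>
      eLpNorm (fun x => (quadChirp z.1 x - 1) * g x) p volume) (𝓝 0) (𝓝 0) :=
    (tendsto_eLpNorm_quadChirp_sub_one_mul hp1 hp (g.memLp p volume)).comp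
      (continuous_fst.tendsto' 0 0 rfl)
  have h2 : Tendsto (fun z : (Fin 2 → ℝ) × (Fin 2 → ℝ) =>
      eLpNorm (fun x => (quadChirp z.2 x - 1) * R x) p volume) (𝓝 0) (𝓝 0) :=
    (tendsto_eLpNorm_quadChirp_sub_one_mul hp1 hp hRm).comp (continuous_snd.tendsto' 0 0 rfl)
  have h3 := (ENNReal.Tendsto.const_mul h1 (Or.inr hC)).add h2
  rw [mul_zero, add_zero] at h3
  exact tendsto_of_tendsto_of_tendsto_of_le_of_le tendsto_const_nhds h3 (fun _ => zero_le) hle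

theorem lpClass_eq {p : ℝ≥0∞} {h : EuclideanSpace ℝ (Fin 2) → ℂ}
    {f : Lp ℂ p (volume : Measure (EuclideanSpace ℝ (Fin 2)))} (hf : f =ᵐ[volume] h) :
    lpClass p h = f := by
  have H : MemLp h p volume := (Lp.memLp f).ae_eq hf
  rw [lpClass, dif_pos H]
  exact Lp.ext (H.coeFn_toLp.trans hf.symm)

/-- A bounded operator which agrees with `T` on Schwartz functions is the extension of `T`: the
limit defining `lpExtend` is along a nontrivial filter by density, and exists by continuity. -/
theorem lpExtend_eq {p : ℝ≥0∞} [Fact (1 ≤ p)] (hp : p < ∞)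
    {T : (EuclideanSpace ℝ (Fin 2) → ℂ) → (EuclideanSpace ℝ (Fin 2) → ℂ)}
    {S : Lp ℂ p (volume : Measure (EuclideanSpace ℝ (Fin 2))) →L[ℂ]
      Lp ℂ p (volume : Measure (EuclideanSpace ℝ (Fin 2)))}
    (hS : ∀ g : 𝓢(EuclideanSpace ℝ (Fin 2), ℂ), S (g.toLp p volume) =ᵐ[volume] T g)
    (f : Lp ℂ p (volume : Measure (EuclideanSpace ℝ (Fin 2)))) :
    lpExtend p T f = S f := by
  have hne : (comap (fun g : 𝓢(EuclideanSpace ℝ (Fin 2), ℂ) => g.toLp p volume) (𝓝 f)).NeBot :=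
    by
    refine comap_neBot fun t ht => ?_
    obtain ⟨_, hx, g, rfl⟩ := mem_closure_iff_nhds.1 (SchwartzMap.denseRange_toLp hp f) t ht
    exact ⟨g, hx⟩
  have heq : (fun g : 𝓢(EuclideanSpace ℝ (Fin 2), ℂ) => lpClass p (T g)) =
      fun g => S (g.toLp p volume) := funext fun g => lpClass_eq (hS g)
  rw [lpExtend, heq]
  exact ((S.continuous.tendsto f).comp tendsto_comap).limUnder_eq

/-- Strong convergence of uniformly bounded operators follows from convergence on a dense set. -/
theorem tendsto_norm_sub_of_dense {ι G E F : Type*} [NormedAddCommGroup E] [NormedSpace ℂ E]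
    [NormedAddCommGroup F] [NormedSpace ℂ F] {l : Filter ι} {S : ι → E →L[ℂ] F} {S₀ : E →L[ℂ] F}
    {C : ℝ} (hS : ∀ i f, ‖S i f‖ ≤ C * ‖f‖) (hS₀ : ∀ f, ‖S₀ f‖ ≤ C * ‖f‖) {e : G → E}
    (he : DenseRange e) (hlim : ∀ g, Tendsto (fun i => ‖S i (e g) - S₀ (e g)‖) l (𝓝 0)) (f : E) :
    Tendsto (fun i => ‖S i f - S₀ f‖) l (𝓝 0) := by
  rw [Metric.tendsto_nhds]
  intro ε hε
  obtain ⟨g, hg⟩ := he.exists_dist_lt f (ε := ε / (4 * (|C| + 1))) (by positivity)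
  rw [dist_eq_norm] at hg
  filter_upwards [(Metric.tendsto_nhds.1 (hlim g)) (ε / 2) (by positivity)] with i hi
  rw [Real.dist_eq, sub_zero, abs_norm] at hi ⊢
  have h1 : S i f - S₀ f = S i (f - e g) + (S i (e g) - S₀ (e g)) - S₀ (f - e g) := by
    rw [map_sub, map_sub]; abel
  have h2 : C * ‖f - e g‖ ≤ ε / 4 := by
    calc C * ‖f - e g‖ ≤ (|C| + 1) * (ε / (4 * (|C| + 1))) := by
          gcongr
          linarith [le_abs_self C]
      _ = ε / 4 := by field_simp
  rw [h1]
  have h3 := norm_sub_le (S i (f - e g) + (S i (e g) - S₀ (e g))) (S₀ (f - e g))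
  have h4 := norm_add_le (S i (f - e g)) (S i (e g) - S₀ (e g))
  linarith [hS i (f - e g), hS₀ (f - e g)]

/-- The parameters of the chirp applied before the Riesz transform. -/
noncomputable def chirpParamIn (A : Fin 2 → Matrix.SpecialLinearGroup (Fin 2) ℝ) : Fin 2 → ℝ :=
  fun k => A k 0 0 / (2 * A k 0 1)

/-- The parameters of the chirp applied after the Riesz transform. -/
noncomputable def chirpParamOut (A : Fin 2 → Matrix.SpecialLinearGroup (Fin 2) ℝ) : Fin 2 → ℝ :=
  fun k => -(A k 1 1) / (2 * A k 0 1)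

/-- Along the limit in question `b ^ 2 = (b / c) (a d - 1)` tends to `1`, so the chirp parameters
tend to zero. -/
theorem tendsto_chirpParam :
    Tendsto (fun A => (chirpParamIn A, chirpParamOut A)) sharpnessLimit (𝓝 0) := by
  have hbase : Tendsto (fun (A : Fin 2 → Matrix.SpecialLinearGroup (Fin 2) ℝ) k =>
      (sharpness (A k), A k 0 0, A k 1 1)) sharpnessLimit (𝓝 fun _ : Fin 2 => ((-1 : ℝ), 0, 0)) :=
    tendsto_comap.mono_left inf_le_left
  have hadm : ∀ᶠ A in sharpnessLimit, Admissible A :=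
    (mem_inf_of_right (mem_principal_self _) : {A | Admissible A} ∈ sharpnessLimit)
  rw [tendsto_pi_nhds] at hbase
  have hs := fun k => (hbase k).fst_nhds
  have ha := fun k => (hbase k).snd_nhds.fst_nhds
  have hd := fun k => (hbase k).snd_nhds.snd_nhds
  simp only at hs ha hd
  have hb : ∀ k, Tendsto (fun A : Fin 2 → Matrix.SpecialLinearGroup (Fin 2) ℝ => A k 0 1 ^ 2)
      sharpnessLimit (𝓝 1) := fun k => by
    have h1 := (hs k).mul (((ha k).mul (hd k)).sub_const 1)
    norm_num at h1
    refine h1.congr' ?_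
    filter_upwards [hadm] with A hA
    have hdet := (A k).det_coe
    rw [Matrix.det_fin_two] at hdet
    have hc := (hA k).2
    rw [sharpness]
    have : A k 0 0 * A k 1 1 - 1 = A k 0 1 * A k 1 0 := by linarith
    rw [this]
    field_simp
  have hquot : ∀ k (u : (Fin 2 → Matrix.SpecialLinearGroup (Fin 2) ℝ) → ℝ),
      Tendsto u sharpnessLimit (𝓝 0) →
      Tendsto (fun A => u A / (2 * A k 0 1)) sharpnessLimit (𝓝 0) := fun k u hu => by
    -- only `b ^ 2` converges, so the quotient is squared first
    have h1 : Tendsto (fun A => Real.sqrt (u A ^ 2 / (4 * A k 0 1 ^ 2))) sharpnessLimit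
        (𝓝 (Real.sqrt (0 ^ 2 / (4 * 1)))) :=
      (Real.continuous_sqrt.tendsto _).comp ((hu.pow 2).div ((hb k).const_mul 4) (by norm_num))
    rw [tendsto_zero_iff_abs_tendsto_zero]
    have h0 : Real.sqrt (0 ^ 2 / (4 * 1)) = 0 := by simp
    rw [h0] at h1
    refine h1.congr fun A => ?_
    rw [Function.comp_apply, ← Real.sqrt_sq_eq_abs, div_pow, mul_pow]
    norm_num
  refine Tendsto.prodMk_nhds (tendsto_pi_nhds.2 fun k => hquot k _ (ha k))
    (tendsto_pi_nhds.2 fun k => hquot k _ ?_)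
  simpa using (hd k).neg

theorem isPV_mul_quadChirp (j : Fin 2) (α : Fin 2 → ℝ) (f : 𝓢(EuclideanSpace ℝ (Fin 2), ℂ))
    (x : EuclideanSpace ℝ (Fin 2)) :
    IsPV x (fun y => ((x j - y j : ℝ) : ℂ) * f y * quadChirp α y / ((‖x - y‖ ^ 3 : ℝ) : ℂ))
      (regRiesz 0 j (fun y => f y * quadChirp α y) x) := by
  simpa only [mul_assoc] using isPV_regRiesz j (f.isTestFunction_mul_quadChirp α) x

theorem lcrt_eq_chirpRiesz (A : Fin 2 → Matrix.SpecialLinearGroup (Fin 2) ℝ) (j : Fin 2)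
    (f : 𝓢(EuclideanSpace ℝ (Fin 2), ℂ)) :
    lcrt A j f = chirpRiesz j (chirpParamIn A) (chirpParamOut A) f := by
  ext x
  rw [chirpRiesz, ← (isPV_mul_quadChirp j (chirpParamIn A) f x).pvIntegral_eq]
  rfl

theorem riesz_eq_chirpRiesz (j : Fin 2) (f : 𝓢(EuclideanSpace ℝ (Fin 2), ℂ)) :
    riesz j f = chirpRiesz j 0 0 f := by
  ext x
  rw [chirpRiesz, ← (isPV_mul_quadChirp j 0 f x).pvIntegral_eq]
  simp only [quadChirp_zero, mul_one]
  rfl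

theorem isLpBounded_and_tendsto_lpExtend {p : ℝ≥0∞} [Fact (1 ≤ p)] (hp1 : 1 < p) (hp : p < ∞)
    (j : Fin 2) :
    (∀ A : Fin 2 → Matrix.SpecialLinearGroup (Fin 2) ℝ, IsLpBounded p (lcrt A j)) ∧
      IsLpBounded p (riesz j : (EuclideanSpace ℝ (Fin 2) → ℂ) → _) ∧
      ∀ f : Lp ℂ p (volume : Measure (EuclideanSpace ℝ (Fin 2))),
        Tendsto (fun A => ‖lpExtend p (lcrt A j) f - lpExtend p (riesz j) f‖)
          sharpnessLimit (𝓝 0) := by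
  obtain ⟨C, S, hS, hSg⟩ := exists_chirpRiesz_extension hp1 hp
  have hA : ∀ (A : Fin 2 → Matrix.SpecialLinearGroup (Fin 2) ℝ)
      (g : 𝓢(EuclideanSpace ℝ (Fin 2), ℂ)),
      S j (chirpParamIn A) (chirpParamOut A) (g.toLp p volume) =ᵐ[volume] lcrt A j g :=
    fun A g => by rw [lcrt_eq_chirpRiesz]; exact hSg j _ _ g
  have h0 : ∀ g : 𝓢(EuclideanSpace ℝ (Fin 2), ℂ),
      S j 0 0 (g.toLp p volume) =ᵐ[volume] riesz j g :=
    fun g => by rw [riesz_eq_chirpRiesz]; exact hSg j _ _ g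
  have hAe := fun A => lpExtend_eq hp (hA A)
  have h0e := lpExtend_eq hp h0
  refine ⟨fun A => ⟨_, hAe A, hA A⟩, ⟨_, h0e, h0⟩, fun f => ?_⟩
  simp_rw [hAe, h0e]
  have key : ∀ g : 𝓢(EuclideanSpace ℝ (Fin 2), ℂ), Tendsto (fun z : (Fin 2 → ℝ) × (Fin 2 → ℝ) =>
      ‖S j z.1 z.2 (g.toLp p volume) - S j 0 0 (g.toLp p volume)‖) (𝓝 0) (𝓝 0) := fun g => by
    have h1 : ∀ z : (Fin 2 → ℝ) × (Fin 2 → ℝ),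
        ‖S j z.1 z.2 (g.toLp p volume) - S j 0 0 (g.toLp p volume)‖ =
          (eLpNorm (chirpRiesz j z.1 z.2 g - chirpRiesz j 0 0 g) p volume).toReal := fun z => by
      rw [Lp.norm_def]
      congr 1
      refine eLpNorm_congr_ae ?_
      exact (Lp.coeFn_sub _ _).trans ((hSg j z.1 z.2 g).sub (hSg j 0 0 g))
    simp_rw [h1]
    exact (ENNReal.tendsto_toReal ENNReal.zero_ne_top).comp
      (tendsto_eLpNorm_chirpRiesz_sub hp1 hp j g)
  have hz : Tendsto (fun z : (Fin 2 → ℝ) × (Fin 2 → ℝ) => ‖S j z.1 z.2 f - S j 0 0 f‖)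
      (𝓝 0) (𝓝 0) :=
    tendsto_norm_sub_of_dense (S := fun z : (Fin 2 → ℝ) × (Fin 2 → ℝ) => S j z.1 z.2)
      (e := fun g : 𝓢(EuclideanSpace ℝ (Fin 2), ℂ) => g.toLp p volume)
      (fun z => hS j z.1 z.2) (hS j 0 0) (SchwartzMap.denseRange_toLp hp) key f
  have hcomp := hz.comp tendsto_chirpParam
  rw [Function.comp_def] at hcomp
  exact hcomp

theorem theorem4p2 :
    -- (i) rewriting of the transforms through the sharpness (the principal values exist)
    (∀ A : Fin 2 → SL(2, ℝ), Admissible A →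
      ∀ (j : Fin 2) (f : 𝓢(EuclideanSpace ℝ (Fin 2), ℂ)) (x : EuclideanSpace ℝ (Fin 2)),
        ∃ L : ℂ,
          IsPV x (fun y => ((x j - y j : ℝ) : ℂ) * f y *
            Complex.exp (Complex.I *
              ((∑ k, A k 0 0 * y k ^ 2 / (2 * sharpness (A k) * A k 1 0) : ℝ) : ℂ)) /
                ((‖x - y‖ ^ 3 : ℝ) : ℂ)) L ∧
          lcrt A j f x = (rieszConst 2 : ℂ) *
            Complex.exp (-Complex.I *
              ((∑ k, A k 1 1 * x k ^ 2 / (2 * sharpness (A k) * A k 1 0) : ℝ) : ℂ)) * L) ∧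
    -- (ii) pointwise convergence for Schwartz functions
    (∀ (j : Fin 2) (f : 𝓢(EuclideanSpace ℝ (Fin 2), ℂ)) (x : EuclideanSpace ℝ (Fin 2)),
      Tendsto (fun A => lcrt A j f x) sharpnessLimit (𝓝 (riesz j f x))) ∧
    -- for `1 < p < ∞` the transforms extend to bounded linear operators on `L^p`, and
    (∀ (p : ℝ≥0∞) [Fact (1 ≤ p)], 1 < p → p < ∞ → ∀ j : Fin 2,
      (∀ A : Fin 2 → SL(2, ℝ), Admissible A → IsLpBounded p (lcrt A j)) ∧
      IsLpBounded p (riesz j : (EuclideanSpace ℝ (Fin 2) → ℂ) → _) ∧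
      ∀ f : Lp ℂ p (volume : Measure (EuclideanSpace ℝ (Fin 2))),
        -- (iii) convergence in norm
        Tendsto (fun A => ‖lpExtend p (lcrt A j) f - lpExtend p (riesz j) f‖)
          sharpnessLimit (𝓝 0) ∧
        -- (iv) convergence as tempered distributions
        Tendsto (fun A => (Lp.toTemperedDistribution (lpExtend p (lcrt A j) f) :
            𝓢'(EuclideanSpace ℝ (Fin 2), ℂ)))
          sharpnessLimit (𝓝 (Lp.toTemperedDistribution (lpExtend p (riesz j) f)))) := by
  refine ⟨fun A hA j f x => ?_, fun j f x => ?_, fun p _ hp1 hp j => ?_⟩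
  · have hb : ∀ k, 2 * sharpness (A k) * A k 1 0 = 2 * A k 0 1 := fun k => by
      rw [mul_assoc, sharpness, div_mul_cancel₀ _ (hA k).2]
    have hin : ∀ y : EuclideanSpace ℝ (Fin 2), quadChirp (chirpParamIn A) y =
        Complex.exp (Complex.I *
          ((∑ k, A k 0 0 * y k ^ 2 / (2 * sharpness (A k) * A k 1 0) : ℝ) : ℂ)) := fun y => by
      simp only [quadChirp, chirpParamIn, hb, div_mul_eq_mul_div]
    have hout : quadChirp (chirpParamOut A) x = Complex.exp (-Complex.I *
        ((∑ k, A k 1 1 * x k ^ 2 / (2 * sharpness (A k) * A k 1 0) : ℝ) : ℂ)) := by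
      simp only [quadChirp, chirpParamOut, hb, div_mul_eq_mul_div, neg_mul, neg_div,
        Finset.sum_neg_distrib, Complex.ofReal_neg, mul_neg]
    refine ⟨regRiesz 0 j (fun y => f y * quadChirp (chirpParamIn A) y) x, ?_, ?_⟩
    · simpa only [hin] using isPV_mul_quadChirp j (chirpParamIn A) f x
    · rw [lcrt_eq_chirpRiesz, chirpRiesz, hout]
  · simp_rw [lcrt_eq_chirpRiesz, riesz_eq_chirpRiesz]
    have h := (tendsto_chirpRiesz j f x).comp tendsto_chirpParam
    rw [Function.comp_def] at h
    exact h
  · have h := isLpBounded_and_tendsto_lpExtend hp1 hp j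
    refine ⟨fun A _ => h.1 A, h.2.1, fun f => ⟨h.2.2 f, ?_⟩⟩
    have h1 : Tendsto (fun A => lpExtend p (lcrt A j) f) sharpnessLimit
        (𝓝 (lpExtend p (riesz j) f)) := tendsto_iff_norm_sub_tendsto_zero.2 (h.2.2 f)
    exact ((Lp.toTemperedDistributionCLM ℂ volume p).continuous.tendsto _).comp h1
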